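/- An operator space is a closed linear subspace $E\subset B(H)$, $H$ a complex Hilbert space; $M_k(E)$ carries the norm induced by $B(\ell_2^k(H))$. For a linear map $u\colon E\to F$ put $\|u\|_{cb}=\sup_{k\ge1}\|I_{M_k}\otimes u\colon M_k(E)\to M_k(F)\|$, and let $d_{cb}(E,F)=\inf\|u\|_{cb}\|u^{-1}\|_{cb}$ over all linear isomorphisms $u\colon E\to F$ (with $d_{cb}(E,F)=\infty$ if $E,F$ are not completely isomorphic). Two spaces are completely isometric if there is a linear isomorphism $u$ between them such that every $I_{M_k}\otimes u$ is isometric. Let $d_{SK}(E)$ be the infimum of $d_{cb}(E,F)$ over all closed subspaces $F$ of the space $K(\ell_2)$ of compact operators on $\ell_2$. The dual $E^*$ has the operator space structure given by $M_k(E^*)=cb(E,M_k)$. Given an ultrafilter $\mathcal U$ on $\mathbf N$, the ultraproduct $\Pi E_i/\mathcal U$ is the Banach space ultraproduct with the structure $M_k(\Pi E_i/\mathcal U)=\Pi M_k(E_i)/\mathcal U$, i.e. the norm of a matrix is the limit along $\mathcal U$ of the norms of its representatives. Let $OS_n$ denote the class of all $n$-dimensional operator spaces. Let $n\ge1$, let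 $\mathcal U$ be a nontrivial (i.e. non-principal) ultrafilter on $\mathbf N$, and let $E\in OS_n$. The following are equivalent: (i) $d_{SK}(E)=d_{SK}(E^*)=1$. (ii) For any sequence $(E_i)_{i\in\mathbf N}$ in $OS_n$ such that $\Pi E_i/\mathcal U$ is completely isometric to $E$ we have $\lim_{\mathcal U}d_{cb}(E,E_i)=1$. (iii) For any sequence $(E_i)_{i\in\mathbf N}$ in $OS_n$ such that each $E_i$ is isometric to $E$ (as a normed space) and $\Pi E_i/\mathcal U$ is completely isometric to $E$ we have $\lim_{\mathcal U}d_{cb}(E,E_i)=1$. -/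

import Mathlib

open Filter Topology
open scoped ENNReal lp

universe u v

noncomputable section

/-- The norm-valued data of a matricially normed space: for every `k`, the norm of a `k × k`
matrix with entries in `E`, as an element of `[0, ∞]`. It is only ever used through the instances
constructed below (`B(H)`, subspaces, duals, ultraproducts). -/
class MatrixNorm (E : Type*) where
  mnorm : ∀ k : ℕ, Matrix (Fin k) (Fin k) E → ℝ≥0∞

namespace OpSp

open MatrixNorm

section BoundedOperators

variable {H : Type*} [NormedAddCommGroup H] [InnerProductSpace ℂ H]

/-- The operator on `ℓ²ₖ(H) = H ⊕ ⋯ ⊕ H` (Hilbert space direct sum) whose block matrix is `a`. -/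
def blockOp {k : ℕ} (a : Matrix (Fin k) (Fin k) (H →L[ℂ] H)) :
    PiLp 2 (fun _ : Fin k => H) →L[ℂ] PiLp 2 (fun _ : Fin k => H) :=
  ((PiLp.continuousLinearEquiv 2 ℂ (fun _ : Fin k => H)).symm :
      (Fin k → H) →L[ℂ] PiLp 2 (fun _ : Fin k => H)) ∘L
    ContinuousLinearMap.pi fun i => ∑ j, a i j ∘L PiLp.proj 2 (fun _ : Fin k => H) j

/-- `Mₖ(B(H))` is normed as `B(ℓ²ₖ(H))`. -/
instance : MatrixNorm (H →L[ℂ] H) where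
  mnorm _ a := ‖blockOp a‖ₑ

end BoundedOperators

/-- A linear subspace carries the induced matrix norms. -/
instance {X : Type*} [AddCommGroup X] [Module ℂ X] [MatrixNorm X] (V : Submodule ℂ X) :
    MatrixNorm V where
  mnorm k a := mnorm k (a.map (fun x : V => (x : X)))

section CompletelyBounded

variable {E F : Type*} [AddCommGroup E] [Module ℂ E] [MatrixNorm E]
  [AddCommGroup F] [Module ℂ F] [MatrixNorm F]

/-- The completely bounded norm `‖u‖_cb = supₖ ‖I ⊗ u : Mₖ(E) → Mₖ(F)‖`, in `[0, ∞]`. -/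
def cbNorm (u : E →ₗ[ℂ] F) : ℝ≥0∞ :=
  ⨆ (k : ℕ) (a : Matrix (Fin k) (Fin k) E) (_ : mnorm k a ≤ 1), mnorm k (a.map u)

variable (E F) in
/-- The distance `d_cb(E, F) = inf ‖u‖_cb ‖u⁻¹‖_cb` over all linear isomorphisms `u : E → F`;
it is `∞` if `E` and `F` are not completely isomorphic. -/
def dcb : ℝ≥0∞ :=
  ⨅ u : E ≃ₗ[ℂ] F, cbNorm (u : E →ₗ[ℂ] F) * cbNorm (u.symm : F →ₗ[ℂ] E)

variable (E F) in
/-- `E` and `F` are completely isometric. -/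
def CompletelyIsometric : Prop :=
  ∃ u : E ≃ₗ[ℂ] F, ∀ (k : ℕ) (a : Matrix (Fin k) (Fin k) E), mnorm k (a.map u) = mnorm k a

variable (E) in
/-- `d_SK(E) = inf d_cb(E, F)` over all closed subspaces `F` of the space `K(ℓ²)` of compact
operators on `ℓ²`. -/
def dSK : ℝ≥0∞ :=
  ⨅ (F : Submodule ℂ (lp (fun _ : ℕ => ℂ) 2 →L[ℂ] lp (fun _ : ℕ => ℂ) 2))
    (_ : IsClosed (F : Set (lp (fun _ : ℕ => ℂ) 2 →L[ℂ] lp (fun _ : ℕ => ℂ) 2)))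
    (_ : ∀ T ∈ F, IsCompactOperator T), dcb E F

end CompletelyBounded

section Dual

variable (E : Type*) [NormedAddCommGroup E] [NormedSpace ℂ E]

/-- The dual of `E`, the space of bounded linear functionals. -/
def OpDual : Type _ := E →L[ℂ] ℂ

instance : AddCommGroup (OpDual E) := inferInstanceAs (AddCommGroup (E →L[ℂ] ℂ))

instance : Module ℂ (OpDual E) := inferInstanceAs (Module ℂ (E →L[ℂ] ℂ))

variable {E}

/-- An element of the dual, as a bounded linear functional. -/
def OpDual.toCLM (f : OpDual E) : E →L[ℂ] ℂ := f

/-- The linear map `E → Mₖ = B(ℓ²ₖ)`, `x ↦ (fᵢⱼ(x))`, given by a matrix of functionals. -/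
def OpDual.toMap {k : ℕ} (f : Matrix (Fin k) (Fin k) (OpDual E)) :
    E →ₗ[ℂ] (EuclideanSpace ℂ (Fin k) →L[ℂ] EuclideanSpace ℂ (Fin k)) where
  toFun x := Matrix.toEuclideanCLM (𝕜 := ℂ) (Matrix.of fun i j => (f i j).toCLM x)
  map_add' x y := by
    rw [← map_add]
    congr 1
    ext i j
    exact map_add (f i j).toCLM x y
  map_smul' c x := by
    rw [RingHom.id_apply, ← map_smul]
    congr 1
    ext i j
    exact map_smul (f i j).toCLM c x

/-- The dual operator space structure: `Mₖ(E*)` is normed as `cb(E, Mₖ)`. -/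
instance [MatrixNorm E] : MatrixNorm (OpDual E) where
  mnorm _ f := cbNorm (OpDual.toMap f)

end Dual

section Ultraproduct

variable {ι : Type*} (U : Ultrafilter ι) (E : ι → Type*) [∀ i, NormedAddCommGroup (E i)]
  [∀ i, NormedSpace ℂ (E i)]

/-- The bounded families `(xᵢ)` with `lim_U ‖xᵢ‖ = 0`. -/
def nullFamilies : Submodule ℂ (lp E ∞) where
  carrier := {x | Tendsto (fun i => ‖x i‖) U (𝓝 0)}
  zero_mem' := by simp
  add_mem' {x y} hx hy := by
    have h : Tendsto (fun i => ‖x i‖ + ‖y i‖) U (𝓝 0) := by simpa using Tendsto.add hx hy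
    exact squeeze_zero (fun _ => norm_nonneg _) (fun i => norm_add_le (x i) (y i)) h
  smul_mem' c x hx := by
    have h : Tendsto (fun i => ‖c‖ * ‖x i‖) U (𝓝 0) := by
      simpa using Tendsto.const_mul ‖c‖ hx
    exact squeeze_zero (fun _ => norm_nonneg _) (fun i => norm_smul_le c (x i)) h

/-- The Banach space ultraproduct `∏ Eᵢ / U`: bounded families modulo the null families. -/
def Ultraproduct : Type _ := lp E ∞ ⧸ nullFamilies U E

instance : AddCommGroup (Ultraproduct U E) :=
  inferInstanceAs (AddCommGroup (lp E ∞ ⧸ nullFamilies U E))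

instance : Module ℂ (Ultraproduct U E) :=
  inferInstanceAs (Module ℂ (lp E ∞ ⧸ nullFamilies U E))

variable {U E}

/-- The class of a bounded family in the ultraproduct. -/
def Ultraproduct.mk (x : lp E ∞) : Ultraproduct U E := Submodule.Quotient.mk x

/-- A bounded family representing an element of the ultraproduct. -/
def Ultraproduct.rep (x : Ultraproduct U E) : lp E ∞ :=
  Quotient.out (s := (nullFamilies U E).quotientRel) x

/-- `Mₖ(∏ Eᵢ / U) = ∏ Mₖ(Eᵢ) / U`: the norm of a matrix is the limit along `U` of the norms in
`Mₖ(Eᵢ)` of the entrywise representatives. The limit of a `[0, ∞]`-valued function along an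
ultrafilter always exists, so it is the upper limit. -/
instance [∀ i, MatrixNorm (E i)] : MatrixNorm (Ultraproduct U E) where
  mnorm k a := limsup (fun i => mnorm k (a.map fun x => x.rep i)) U

end Ultraproduct

end OpSp

/-- An operator space: a closed linear subspace of `B(H)`, for a complex Hilbert space `H`. -/
structure OperatorSpace where
  /-- the Hilbert space -/
  H : Type u
  [normed : NormedAddCommGroup H]
  [inner : InnerProductSpace ℂ H]
  [complete : CompleteSpace H]
  /-- the subspace -/
  carrier : Submodule ℂ (H →L[ℂ] H)
  isClosed : IsClosed (carrier : Set (H →L[ℂ] H))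

namespace OperatorSpace

attribute [instance] normed inner complete

instance : CoeSort OperatorSpace.{u} (Type u) := ⟨fun E => E.carrier⟩

/-- The `n`-dimensional operator spaces. -/
def OS (n : ℕ) : Set OperatorSpace.{u} :=
  {E | FiniteDimensional ℂ E ∧ Module.finrank ℂ E = n}

end OperatorSpace

end

open OpSp OperatorSpace

/-! (i) ⇒ (ii). A complete isometry from the ultraproduct onto E is represented by linear maps u_i :
E → E_i such that the norm of (I ⊗ u_i)(a) tends to ‖a‖ along U for each single matrix a
(`exists_maps_of_ultraproduct`). The two halves of (i) upgrade this to cb norms. If E* embeds in M_N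
with distortion close to 1, the embedding is by duality one matrix t over E, and ‖u‖_cb is
controlled by the norm of (I ⊗ u)(t) alone (`exists_matrix_cbNorm_le`). If E embeds in M_N with
distortion close to 1, the cb norm of the inverse of u_i is controlled on N × N matrices by Smith's
lemma (`norm_blockOp_map_le_of_le`), and there pointwise convergence is uniform because M_N(E) is
finite-dimensional (`eventually_seminorm_le`).

(iii) ⇒ (i). Among the structures on E that agree with the given one on matrices of size at most N
there is a smallest, defined by the complete contractions into M_m with m ≤ N, and a largest,
defined by all maps into matrix algebras that are contractive up to size N. With N = i + 1, either
choice gives a sequence with ultraproduct E, since each matrix level is eventually unchanged and U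
is non-principal. The smallest structure and the dual of the largest both have d_SK ≤ 1: their norms
are suprema over maps into matrix algebras of bounded size, and by compactness a finite subfamily
nearly attains them (`dSK_le_one_of_mnorm_eq_iSup`). Since d_SK(E) ≤ d_cb(E, F) as soon as d_SK(F) ≤
1, and d_cb does not increase under duality, (iii) applied to the two sequences gives the two halves
of (i). -/

namespace OpSp
open MatrixNorm

/-! ### Block operators and their norms -/

section Block

variable {H : Type*} [NormedAddCommGroup H] [InnerProductSpace ℂ H] {k N : ℕ}

lemma blockOp_apply (a : Matrix (Fin k) (Fin k) (H →L[ℂ] H)) (ξ : PiLp 2 (fun _ : Fin k => H))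
    (i : Fin k) : blockOp a ξ i = ∑ j, a i j (ξ j) := by
  simp [blockOp]

lemma mnorm_eq_enorm_blockOp (a : Matrix (Fin k) (Fin k) (H →L[ℂ] H)) :
    mnorm k a = ‖blockOp a‖ₑ := rfl

lemma mnorm_coe {V : Submodule ℂ (H →L[ℂ] H)} (a : Matrix (Fin k) (Fin k) V) :
    mnorm k a = mnorm k (a.map V.subtype) := rfl

lemma mnorm_le_mul_iff {H' : Type*} [NormedAddCommGroup H'] [InnerProductSpace ℂ H'] {k' : ℕ}
    {C : ℝ} (hC : 0 ≤ C)
    {a : Matrix (Fin k) (Fin k) (H →L[ℂ] H)} {b : Matrix (Fin k') (Fin k') (H' →L[ℂ] H')} :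
    mnorm k a ≤ ENNReal.ofReal C * mnorm k' b ↔ ‖blockOp a‖ ≤ C * ‖blockOp b‖ := by
  rw [mnorm_eq_enorm_blockOp, mnorm_eq_enorm_blockOp, ← ofReal_norm, ← ofReal_norm,
    ← ENNReal.ofReal_mul hC, ENNReal.ofReal_le_ofReal_iff (by positivity)]

lemma mnorm_le_iff {H' : Type*} [NormedAddCommGroup H'] [InnerProductSpace ℂ H'] {k' : ℕ}
    {a : Matrix (Fin k) (Fin k) (H →L[ℂ] H)} {b : Matrix (Fin k') (Fin k') (H' →L[ℂ] H')} :
    mnorm k a ≤ mnorm k' b ↔ ‖blockOp a‖ ≤ ‖blockOp b‖ := by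
  simpa using mnorm_le_mul_iff (a := a) (b := b) zero_le_one

lemma inner_blockOp (a : Matrix (Fin k) (Fin k) (H →L[ℂ] H))
    (ξ η : PiLp 2 (fun _ : Fin k => H)) :
    inner ℂ η (blockOp a ξ) = ∑ i, ∑ j, inner ℂ (η i) (a i j (ξ j)) := by
  simp [PiLp.inner_apply, blockOp_apply, inner_sum]

lemma norm_sum_inner_le (a : Matrix (Fin k) (Fin k) (H →L[ℂ] H))
    (ξ η : PiLp 2 (fun _ : Fin k => H)) :
    ‖∑ i, ∑ j, inner ℂ (η i) (a i j (ξ j))‖ ≤ ‖blockOp a‖ * ‖ξ‖ * ‖η‖ := by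
  rw [← inner_blockOp, mul_comm]
  exact (norm_inner_le_norm _ _).trans
    (mul_le_mul_of_nonneg_left ((blockOp a).le_opNorm ξ) (norm_nonneg _))

lemma norm_blockOp_le {a : Matrix (Fin k) (Fin k) (H →L[ℂ] H)} {C : ℝ} (hC : 0 ≤ C)
    (h : ∀ ξ η : PiLp 2 (fun _ : Fin k => H),
      ‖∑ i, ∑ j, inner ℂ (η i) (a i j (ξ j))‖ ≤ C * ‖ξ‖ * ‖η‖) : ‖blockOp a‖ ≤ C := by
  refine ContinuousLinearMap.opNorm_le_bound _ hC fun ξ => ?_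
  -- Testing against the image of ξ itself recovers the operator norm from the sesquilinear form.
  have h1 := h ξ (blockOp a ξ)
  rw [← inner_blockOp, inner_self_eq_norm_sq_to_K] at h1
  rcases eq_or_lt_of_le (norm_nonneg (blockOp a ξ)) with h0 | h0
  · rw [← h0]; positivity
  · have h2 : ‖blockOp a ξ‖ * ‖blockOp a ξ‖ ≤ C * ‖ξ‖ * ‖blockOp a ξ‖ := by
      simpa [pow_two] using h1
    exact le_of_mul_le_mul_right h2 h0

lemma blockOp_add (a b : Matrix (Fin k) (Fin k) (H →L[ℂ] H)) :
    blockOp (a + b) = blockOp a + blockOp b := by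
  ext ξ i
  simp [blockOp_apply, Finset.sum_add_distrib]

lemma blockOp_smul (c : ℂ) (a : Matrix (Fin k) (Fin k) (H →L[ℂ] H)) :
    blockOp (c • a) = c • blockOp a := by
  ext ξ i
  simp [blockOp_apply, Finset.smul_sum]

lemma blockOp_zero : blockOp (0 : Matrix (Fin k) (Fin k) (H →L[ℂ] H)) = 0 := by
  ext ξ i
  simp [blockOp_apply]

lemma blockOp_sum {ι : Type*} (s : Finset ι) (a : ι → Matrix (Fin k) (Fin k) (H →L[ℂ] H)) :
    blockOp (∑ l ∈ s, a l) = ∑ l ∈ s, blockOp (a l) := by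
  classical
  induction s using Finset.induction_on with
  | empty => simp [blockOp_zero]
  | insert l s hl ih => rw [Finset.sum_insert hl, Finset.sum_insert hl, blockOp_add, ih]

lemma norm_entry_le (a : Matrix (Fin k) (Fin k) (H →L[ℂ] H)) (i j : Fin k) :
    ‖a i j‖ ≤ ‖blockOp a‖ := by
  refine ContinuousLinearMap.opNorm_le_bound _ (norm_nonneg (blockOp a)) fun h => ?_
  have h1 := (blockOp a).le_opNorm (PiLp.single 2 j h)
  rw [PiLp.norm_single] at h1
  refine le_trans ?_ h1
  have h2 : blockOp a (PiLp.single 2 j h) i = a i j h := by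
    rw [blockOp_apply, Finset.sum_eq_single j]
    · simp
    · intro b _ hb
      simp [hb]
    · simp
  rw [← h2]
  exact PiLp.norm_apply_le _ _

lemma eq_zero_of_norm_blockOp {a : Matrix (Fin k) (Fin k) (H →L[ℂ] H)} (h : ‖blockOp a‖ = 0) :
    a = 0 := by
  ext1 i j
  exact norm_le_zero_iff.mp ((norm_entry_le a i j).trans_eq h)

lemma norm_blockOp_add_le (a b : Matrix (Fin k) (Fin k) (H →L[ℂ] H)) :
    ‖blockOp (a + b)‖ ≤ ‖blockOp a‖ + ‖blockOp b‖ := by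
  rw [blockOp_add]
  exact norm_add_le (blockOp a) _

lemma norm_blockOp_smul (c : ℂ) (a : Matrix (Fin k) (Fin k) (H →L[ℂ] H)) :
    ‖blockOp (c • a)‖ = ‖c‖ * ‖blockOp a‖ := by
  have h : ∀ (c : ℂ) (a : Matrix (Fin k) (Fin k) (H →L[ℂ] H)),
      ‖blockOp (c • a)‖ ≤ ‖c‖ * ‖blockOp a‖ := fun c a => by
    rw [blockOp_smul]
    exact ContinuousLinearMap.opNorm_smul_le c (blockOp a)
  refine le_antisymm (h c a) ?_
  rcases eq_or_ne c 0 with rfl | hc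
  · rw [norm_zero, zero_mul]
    exact norm_nonneg (blockOp ((0:ℂ) • a))
  have h1 := h c⁻¹ (c • a)
  rw [inv_smul_smul₀ hc, norm_inv] at h1
  rwa [← le_div_iff₀' (norm_pos_iff.mpr hc), div_eq_inv_mul]

lemma norm_blockOp_le_sum (a : Matrix (Fin k) (Fin k) (H →L[ℂ] H)) :
    ‖blockOp a‖ ≤ ∑ i, ∑ j, ‖a i j‖ := by
  refine norm_blockOp_le (by positivity) fun ξ η => ?_
  rw [Finset.sum_mul, Finset.sum_mul]
  refine (norm_sum_le _ _).trans (Finset.sum_le_sum fun i _ => ?_)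
  rw [Finset.sum_mul, Finset.sum_mul]
  refine (norm_sum_le _ _).trans (Finset.sum_le_sum fun j _ => ?_)
  calc _ ≤ ‖η i‖ * ‖a i j (ξ j)‖ := norm_inner_le_norm _ _
    _ ≤ ‖η‖ * (‖a i j‖ * ‖ξ‖) := by
        gcongr
        · exact PiLp.norm_apply_le _ _
        · exact ((a i j).le_opNorm _).trans
            (mul_le_mul_of_nonneg_left (PiLp.norm_apply_le _ _) (norm_nonneg _))
    _ = _ := by ring

/-- The action of a scalar matrix on tuples of vectors. -/
def scalarMul (A : Matrix (Fin k) (Fin N) ℂ) (ξ : PiLp 2 (fun _ : Fin N => H)) :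
    PiLp 2 (fun _ : Fin k => H) :=
  WithLp.toLp 2 fun j => ∑ q, A j q • ξ q

/-- A ⊗ I_H has the norm of A: in an orthonormal basis of the span of the ξ q, the matrix acts on
each coordinate separately. -/
lemma norm_scalarMul_le {A : Matrix (Fin k) (Fin N) ℂ} {M : ℝ} (hM : 0 ≤ M)
    (hA : ∀ x : EuclideanSpace ℂ (Fin N), ‖scalarMul A x‖ ≤ M * ‖x‖)
    (ξ : PiLp 2 (fun _ : Fin N => H)) : ‖scalarMul A ξ‖ ≤ M * ‖ξ‖ := by
  let S := Submodule.span ℂ (Set.range ξ)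
  have : FiniteDimensional ℂ S := FiniteDimensional.span_of_finite ℂ (Set.finite_range _)
  let b := stdOrthonormalBasis ℂ S
  let ζ : Fin N → S := fun q => ⟨ξ q, Submodule.subset_span ⟨q, rfl⟩⟩
  have hn : ∀ h : S, ‖(h : H)‖ ^ 2 = ∑ l, ‖inner ℂ (b l) h‖ ^ 2 := fun h =>
    (b.sum_sq_norm_inner_right h).symm
  refine abs_le_of_sq_le_sq' ?_ (by positivity) |>.2
  rw [mul_pow, PiLp.norm_sq_eq_of_L2, PiLp.norm_sq_eq_of_L2]
  have h1 : ∀ j, ‖scalarMul A ξ j‖ ^ 2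
      = ∑ l, ‖∑ q, A j q * inner ℂ (b l) (ζ q)‖ ^ 2 := fun j => by
    have : scalarMul A ξ j = ((∑ q, A j q • ζ q : S) : H) := by simp [scalarMul, ζ]
    rw [this, hn]
    simp
  have h2 : ∀ q, ‖ξ q‖ ^ 2 = ∑ l, ‖inner ℂ (b l) (ζ q)‖ ^ 2 := fun q => hn (ζ q)
  simp_rw [h1, h2]
  rw [Finset.sum_comm, Finset.sum_comm (s := (Finset.univ : Finset (Fin N))), Finset.mul_sum]
  refine Finset.sum_le_sum fun l _ => ?_
  have h3 := pow_le_pow_left₀ (norm_nonneg _)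
    (hA (WithLp.toLp 2 fun q => inner ℂ (b l) (ζ q))) 2
  rw [mul_pow, PiLp.norm_sq_eq_of_L2, PiLp.norm_sq_eq_of_L2] at h3
  simpa [scalarMul] using h3

end Block

/-! ### Multiplication by scalar matrices on both sides -/

section Sandwich

variable {X Y : Type*} [AddCommGroup X] [Module ℂ X] [AddCommGroup Y] [Module ℂ Y] {k N : ℕ}

/-- The matrix `B* a A`, for scalar matrices `A` and `B`. -/
def sandwich (B A : Matrix (Fin k) (Fin N) ℂ) (a : Matrix (Fin k) (Fin k) X) :
    Matrix (Fin N) (Fin N) X :=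
  Matrix.of fun p q => ∑ i, ∑ j, (star (B i p) * A j q) • a i j

lemma sandwich_map (B A : Matrix (Fin k) (Fin N) ℂ) (a : Matrix (Fin k) (Fin k) X)
    (φ : X →ₗ[ℂ] Y) : (sandwich B A a).map φ = sandwich B A (a.map φ) := by
  ext p q
  simp [sandwich]

lemma sum_inner_sandwich {H : Type*} [NormedAddCommGroup H] [InnerProductSpace ℂ H]
    (B A : Matrix (Fin k) (Fin N) ℂ) (a : Matrix (Fin k) (Fin k) (H →L[ℂ] H))
    (ξ η : PiLp 2 (fun _ : Fin N => H)) :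
    ∑ p, ∑ q, inner ℂ (η p) (sandwich B A a p q (ξ q))
      = ∑ i, ∑ j, inner ℂ (scalarMul B η i) (a i j (scalarMul A ξ j)) := by
  simp only [sandwich, scalarMul, Matrix.of_apply, _root_.sum_apply,
    _root_.smul_apply, inner_sum, sum_inner, map_sum, map_smul, inner_smul_right,
    inner_smul_left]
  rw [Finset.sum_congr rfl fun p _ => Finset.sum_comm, Finset.sum_comm]
  refine Finset.sum_congr rfl fun i _ => ?_
  rw [Finset.sum_congr rfl fun p _ => Finset.sum_comm, Finset.sum_comm]
  refine Finset.sum_congr rfl fun j _ => ?_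
  rw [Finset.sum_comm]
  refine Finset.sum_congr rfl fun q _ => ?_
  rw [Finset.mul_sum]
  refine Finset.sum_congr rfl fun p _ => ?_
  simp only [RCLike.star_def]
  ring

lemma norm_blockOp_sandwich_le {H : Type*} [NormedAddCommGroup H] [InnerProductSpace ℂ H]
    {B A : Matrix (Fin k) (Fin N) ℂ} {M L : ℝ} (hM : 0 ≤ M) (hL : 0 ≤ L)
    (hB : ∀ x : EuclideanSpace ℂ (Fin N), ‖scalarMul B x‖ ≤ M * ‖x‖)
    (hA : ∀ x : EuclideanSpace ℂ (Fin N), ‖scalarMul A x‖ ≤ L * ‖x‖)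
    (a : Matrix (Fin k) (Fin k) (H →L[ℂ] H)) :
    ‖blockOp (sandwich B A a)‖ ≤ M * L * ‖blockOp a‖ := by
  refine norm_blockOp_le (by positivity) fun ξ η => ?_
  rw [sum_inner_sandwich]
  refine (norm_sum_inner_le a _ _).trans ?_
  calc _ ≤ ‖blockOp a‖ * (L * ‖ξ‖) * (M * ‖η‖) := by
        gcongr
        · exact norm_scalarMul_le hL hA ξ
        · exact norm_scalarMul_le hM hB η
    _ = _ := by ring

end Sandwich

/-! ### Factorization of vectors and Smith's lemma -/

section Factorization

variable {H : Type*} [NormedAddCommGroup H] [InnerProductSpace ℂ H] {k m N : ℕ}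

/-- The vectors span a space of dimension at most m ≤ N. The v q are an orthonormal basis of it
padded with zeros, and c s is the coordinate vector of h s. -/
lemma exists_orthogonal_factorization (hmN : m ≤ N) (h : Fin m → H) :
    ∃ (v : Fin N → H) (c : Fin m → EuclideanSpace ℂ (Fin N)),
      (∀ x : EuclideanSpace ℂ (Fin N), ‖∑ q, x q • v q‖ ≤ ‖x‖) ∧
      (∀ s, h s = ∑ q, c s q • v q) ∧ ∀ s, ‖c s‖ = ‖h s‖ := by
  let S := Submodule.span ℂ (Set.range h)
  have : FiniteDimensional ℂ S := FiniteDimensional.span_of_finite ℂ (Set.finite_range _)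
  have hd : Module.finrank ℂ S ≤ N :=
    (finrank_range_le_card (R := ℂ) h).trans (by simpa using hmN)
  let b := stdOrthonormalBasis ℂ S
  obtain ⟨e, rfl⟩ := Nat.exists_eq_add_of_le hd
  let ζ : Fin m → S := fun q => ⟨h q, Submodule.subset_span ⟨q, rfl⟩⟩
  refine ⟨Fin.addCases (fun l => (b l : H)) (fun _ => 0),
    fun s => WithLp.toLp 2 (Fin.addCases (fun l => b.repr (ζ s) l) (fun _ => 0)),
    fun x => ?_, fun s => ?_, fun s => ?_⟩
  · let x' : EuclideanSpace ℂ (Fin (Module.finrank ℂ S)) :=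
      WithLp.toLp 2 fun l => x (Fin.castAdd e l)
    have h1 : ∑ q, x q • (Fin.addCases (fun l => (b l : H)) (fun _ => 0) q : H)
        = (b.repr.symm x' : S) := by
      rw [Fin.sum_univ_add, ← b.sum_repr_symm]
      simp [x']
    rw [h1]
    change ‖b.repr.symm x'‖ ≤ _
    rw [LinearIsometryEquiv.norm_map]
    refine abs_le_of_sq_le_sq' ?_ (norm_nonneg _) |>.2
    rw [PiLp.norm_sq_eq_of_L2, PiLp.norm_sq_eq_of_L2, Fin.sum_univ_add]
    exact le_add_of_nonneg_right (by positivity)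
  · rw [Fin.sum_univ_add]
    have h1 : h s = ((∑ l, b.repr (ζ s) l • b l : S) : H) := by rw [b.sum_repr]
    simpa using h1
  · have h1 : ‖h s‖ = ‖b.repr (ζ s)‖ := by rw [LinearIsometryEquiv.norm_map]; rfl
    rw [h1, ← sq_eq_sq₀ (norm_nonneg _) (norm_nonneg _), PiLp.norm_sq_eq_of_L2,
      PiLp.norm_sq_eq_of_L2, Fin.sum_univ_add]
    simp

/-- A vector of `ℓ²ₖ ⊗ ℓ²ₘ` lies in a copy of `ℓ²_N ⊗ ℓ²ₘ` as soon as `m ≤ N`. -/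
lemma exists_scalarMul_eq (hmN : m ≤ N) (ξ : PiLp 2 (fun _ : Fin k => EuclideanSpace ℂ (Fin m))) :
    ∃ (A : Matrix (Fin k) (Fin N) ℂ) (ξ' : PiLp 2 (fun _ : Fin N => EuclideanSpace ℂ (Fin m))),
      (∀ x : EuclideanSpace ℂ (Fin N), ‖scalarMul A x‖ ≤ 1 * ‖x‖) ∧ scalarMul A ξ' = ξ ∧
      ‖ξ'‖ = ‖ξ‖ := by
  -- ξ is read as m vectors of ℓ²ₖ rather than k vectors of ℓ²ₘ, so that its rank is bounded by m
  -- whatever k is.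
  obtain ⟨v, c, hv, hc, hn⟩ := exists_orthogonal_factorization hmN
    (fun s : Fin m => (WithLp.toLp 2 fun j => ξ j s : EuclideanSpace ℂ (Fin k)))
  refine ⟨Matrix.of fun j q => v q j, WithLp.toLp 2 fun q => WithLp.toLp 2 fun s => c s q,
    fun x => ?_, ?_, ?_⟩
  · have h1 : scalarMul (Matrix.of fun j q => v q j) x = ∑ q, x q • v q := by
      ext j
      simp [scalarMul, mul_comm]
    rw [one_mul, h1]
    exact hv x
  · ext j s
    have := congrArg (fun y : EuclideanSpace ℂ (Fin k) => y j) (hc s)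
    simp only at this
    simp [scalarMul, this, mul_comm]
  · rw [← sq_eq_sq₀ (norm_nonneg _) (norm_nonneg _), PiLp.norm_sq_eq_of_L2,
      PiLp.norm_sq_eq_of_L2]
    simp_rw [PiLp.norm_sq_eq_of_L2]
    rw [Finset.sum_comm, Finset.sum_comm (s := (Finset.univ : Finset (Fin k)))]
    refine Finset.sum_congr rfl fun s _ => ?_
    have := congrArg (· ^ 2) (hn s)
    simpa [PiLp.norm_sq_eq_of_L2] using this

/-- The complete bound of a map into `Mₘ` is attained on `N × N` matrices, for `m ≤ N`. -/
lemma norm_blockOp_map_le_of_le {X : Type*} [AddCommGroup X] [Module ℂ X] (hmN : m ≤ N)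
    (θ : X →ₗ[ℂ] (H →L[ℂ] H))
    (ψ : X →ₗ[ℂ] (EuclideanSpace ℂ (Fin m) →L[ℂ] EuclideanSpace ℂ (Fin m))) {C : ℝ} (hC : 0 ≤ C)
    (h : ∀ a : Matrix (Fin N) (Fin N) X, ‖blockOp (a.map ψ)‖ ≤ C * ‖blockOp (a.map θ)‖)
    (a : Matrix (Fin k) (Fin k) X) : ‖blockOp (a.map ψ)‖ ≤ C * ‖blockOp (a.map θ)‖ := by
  refine norm_blockOp_le (by positivity) fun ξ η => ?_
  -- The scalar contractions A and B move from the vectors to the matrix, which becomes the N × N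
  -- matrix B* a A.
  obtain ⟨A, ξ', hA, rfl, hξ⟩ := exists_scalarMul_eq hmN ξ
  obtain ⟨B, η', hB, rfl, hη⟩ := exists_scalarMul_eq hmN η
  rw [← sum_inner_sandwich, ← sandwich_map, ← hξ, ← hη]
  refine (norm_sum_inner_le _ _ _).trans ?_
  gcongr
  refine (h _).trans ?_
  gcongr
  rw [sandwich_map]
  simpa using norm_blockOp_sandwich_le zero_le_one zero_le_one hB hA (a.map θ)

lemma norm_toLp_map_le {G : Type*} [NormedAddCommGroup G] [InnerProductSpace ℂ G]
    (W : G →L[ℂ] H) (ξ : PiLp 2 (fun _ : Fin k => G)) :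
    ‖(WithLp.toLp 2 fun i => W (ξ i) : PiLp 2 (fun _ : Fin k => H))‖ ≤ ‖W‖ * ‖ξ‖ := by
  refine abs_le_of_sq_le_sq' ?_ (by positivity) |>.2
  rw [mul_pow, PiLp.norm_sq_eq_of_L2, PiLp.norm_sq_eq_of_L2, Finset.mul_sum]
  refine Finset.sum_le_sum fun i _ => ?_
  rw [← mul_pow]
  exact pow_le_pow_left₀ (norm_nonneg _) (W.le_opNorm _) 2

/-- The k vectors lie in a subspace of dimension at most k. Hence a coefficient of a k × k matrix
over B(H) can be computed after compressing to ℓ²ₖ. -/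
lemma exists_contraction_eq (ξ : PiLp 2 (fun _ : Fin k => H)) :
    ∃ (W : EuclideanSpace ℂ (Fin k) →L[ℂ] H)
      (ξ' : PiLp 2 (fun _ : Fin k => EuclideanSpace ℂ (Fin k))),
      ‖W‖ ≤ 1 ∧ (∀ j, W (ξ' j) = ξ j) ∧ ‖ξ'‖ = ‖ξ‖ := by
  obtain ⟨v, c, hv, hc, hn⟩ := exists_orthogonal_factorization le_rfl ξ
  let W₀ : EuclideanSpace ℂ (Fin k) →ₗ[ℂ] H :=
    { toFun := fun x => ∑ q, x q • v q
      map_add' := fun x y => by simp [add_smul, Finset.sum_add_distrib]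
      map_smul' := fun r x => by simp [mul_smul, Finset.smul_sum] }
  refine ⟨W₀.mkContinuous 1 fun x => (hv x).trans_eq (one_mul _).symm, WithLp.toLp 2 c,
    LinearMap.mkContinuous_norm_le _ zero_le_one _, fun j => (hc j).symm, ?_⟩
  rw [← sq_eq_sq₀ (norm_nonneg _) (norm_nonneg _), PiLp.norm_sq_eq_of_L2,
    PiLp.norm_sq_eq_of_L2]
  simp [hn]

end Factorization

/-! ### Compressions and complete contractions into matrix algebras -/

section Compression

variable {H G : Type*} [NormedAddCommGroup H] [InnerProductSpace ℂ H] [CompleteSpace H]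
  [NormedAddCommGroup G] [InnerProductSpace ℂ G] [CompleteSpace G] {k N : ℕ}

/-- The map `T ↦ W* T V`. -/
noncomputable def compression (W V : G →L[ℂ] H) : (H →L[ℂ] H) →ₗ[ℂ] (G →L[ℂ] G) where
  toFun T := (ContinuousLinearMap.adjoint W) ∘L T ∘L V
  map_add' S T := by ext; simp
  map_smul' c T := by ext; simp

lemma sum_inner_compression (W V : G →L[ℂ] H) (a : Matrix (Fin k) (Fin k) (H →L[ℂ] H))
    (ξ η : Fin k → G) :
    ∑ i, ∑ j, inner ℂ (η i) (a.map (compression W V) i j (ξ j))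
      = ∑ i, ∑ j, inner ℂ (W (η i)) (a i j (V (ξ j))) := by
  simp [compression, ContinuousLinearMap.adjoint_inner_right]

lemma norm_blockOp_compression_le (W V : G →L[ℂ] H) (a : Matrix (Fin k) (Fin k) (H →L[ℂ] H)) :
    ‖blockOp (a.map (compression W V))‖ ≤ ‖W‖ * ‖V‖ * ‖blockOp a‖ := by
  refine norm_blockOp_le (by positivity) fun ξ η => ?_
  rw [sum_inner_compression]
  refine (norm_sum_inner_le a (WithLp.toLp 2 fun i => V (ξ i))
    (WithLp.toLp 2 fun i => W (η i))).trans ?_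
  calc _ ≤ ‖blockOp a‖ * (‖V‖ * ‖ξ‖) * (‖W‖ * ‖η‖) := by
        gcongr
        · exact norm_toLp_map_le V ξ
        · exact norm_toLp_map_le W η
    _ = _ := by ring

lemma norm_blockOp_compression_le_of_norm_le_one {W V : G →L[ℂ] H} (hW : ‖W‖ ≤ 1) (hV : ‖V‖ ≤ 1)
    (a : Matrix (Fin k) (Fin k) (H →L[ℂ] H)) :
    ‖blockOp (a.map (compression W V))‖ ≤ ‖blockOp a‖ := by
  refine (norm_blockOp_compression_le W V a).trans ?_
  calc _ ≤ 1 * 1 * ‖blockOp a‖ := by gcongr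
    _ = _ := by ring

/-- Matrices over `B(H)` are normed by the complete contractions into matrix algebras. -/
lemma mnorm_le_of_forall_completeContraction (a : Matrix (Fin k) (Fin k) (H →L[ℂ] H)) (C : ℝ≥0∞)
    (h : ∀ φ : (H →L[ℂ] H) →ₗ[ℂ] (EuclideanSpace ℂ (Fin k) →L[ℂ] EuclideanSpace ℂ (Fin k)),
      (∀ (m : ℕ) (b : Matrix (Fin m) (Fin m) (H →L[ℂ] H)), mnorm m (b.map φ) ≤ mnorm m b) →
      mnorm k (a.map φ) ≤ C) : mnorm k a ≤ C := by
  rcases eq_or_ne C ⊤ with rfl | hC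
  · exact le_top
  rw [mnorm_eq_enorm_blockOp, ← ofReal_norm]
  refine ENNReal.ofReal_le_of_le_toReal (norm_blockOp_le ENNReal.toReal_nonneg fun ξ η => ?_)
  obtain ⟨V, ξ', hV, hξ, hξn⟩ := exists_contraction_eq ξ
  obtain ⟨W, η', hW, hη, hηn⟩ := exists_contraction_eq η
  -- The complete contraction T ↦ W* T V is adapted to the chosen pair ξ, η, and retains the
  -- coefficient to be bounded.
  have h1 := h (compression W V) fun m b => by
    rw [mnorm_le_iff]
    exact norm_blockOp_compression_le_of_norm_le_one hW hV b
  rw [mnorm_eq_enorm_blockOp, ← ofReal_norm, ENNReal.ofReal_le_iff_le_toReal hC] at h1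
  simp_rw [← hξ, ← hη]
  rw [← sum_inner_compression, ← hξn, ← hηn]
  exact (norm_sum_inner_le _ _ _).trans (by gcongr)

end Compression

/-! ### The identification of M_k(M_N) with M_N(M_k) -/

section Flip

variable {k N : ℕ}

/-- The two block operators are intertwined by the isometry τ exchanging the factors of ℓ²ₖ ⊗ ℓ²_N.
The hypothesis is symmetric in a and b, so one inequality suffices. -/
lemma norm_blockOp_flip_le
    (a : Matrix (Fin k) (Fin k) (EuclideanSpace ℂ (Fin N) →L[ℂ] EuclideanSpace ℂ (Fin N)))
    (b : Matrix (Fin N) (Fin N) (EuclideanSpace ℂ (Fin k) →L[ℂ] EuclideanSpace ℂ (Fin k)))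
    (h : ∀ i j p q, a i j (EuclideanSpace.single q 1) p = b p q (EuclideanSpace.single j 1) i) :
    ‖blockOp a‖ ≤ ‖blockOp b‖ := by
  have key : ∀ {n : ℕ} (T : EuclideanSpace ℂ (Fin n) →L[ℂ] EuclideanSpace ℂ (Fin n))
      (x y : EuclideanSpace ℂ (Fin n)), inner ℂ y (T x)
        = ∑ p, ∑ q, T (EuclideanSpace.single q 1) p * (x q * star (y p)) := by
    intro n T x y
    have hx : x = ∑ q, x q • EuclideanSpace.single q (1 : ℂ) := by
      ext i
      simp [Pi.single_apply]
    conv_lhs => rw [hx]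
    simp only [map_sum, map_smul, PiLp.inner_apply, WithLp.ofLp_sum, WithLp.ofLp_smul, Finset.sum_apply, Pi.smul_apply, smul_eq_mul,
      RCLike.inner_apply, Finset.sum_mul, RCLike.star_def]
    refine Finset.sum_congr rfl fun p _ => Finset.sum_congr rfl fun q _ => ?_
    ring
  let τ : ∀ ξ : PiLp 2 (fun _ : Fin k => EuclideanSpace ℂ (Fin N)),
      PiLp 2 (fun _ : Fin N => EuclideanSpace ℂ (Fin k)) :=
    fun ξ => WithLp.toLp 2 fun q => WithLp.toLp 2 fun j => ξ j q
  have hτ : ∀ ξ, ‖τ ξ‖ = ‖ξ‖ := fun ξ => by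
    rw [← sq_eq_sq₀ (norm_nonneg _) (norm_nonneg _), PiLp.norm_sq_eq_of_L2,
      PiLp.norm_sq_eq_of_L2]
    simp_rw [PiLp.norm_sq_eq_of_L2]
    rw [Finset.sum_comm]
  refine norm_blockOp_le (norm_nonneg (blockOp b)) fun ξ η => ?_
  rw [← hτ ξ, ← hτ η]
  refine le_of_eq_of_le ?_ (norm_sum_inner_le b (τ ξ) (τ η))
  congr 1
  simp_rw [key, h]
  have swap : ∀ f : Fin k → Fin k → Fin N → Fin N → ℂ,
      ∑ i, ∑ j, ∑ p, ∑ q, f i j p q = ∑ p, ∑ q, ∑ i, ∑ j, f i j p q := fun f => by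
    rw [Finset.sum_congr rfl fun i _ => Finset.sum_comm, Finset.sum_comm]
    refine Finset.sum_congr rfl fun p _ => ?_
    rw [Finset.sum_congr rfl fun i _ => Finset.sum_comm, Finset.sum_comm]
  exact swap _

lemma norm_blockOp_flip
    (a : Matrix (Fin k) (Fin k) (EuclideanSpace ℂ (Fin N) →L[ℂ] EuclideanSpace ℂ (Fin N)))
    (b : Matrix (Fin N) (Fin N) (EuclideanSpace ℂ (Fin k) →L[ℂ] EuclideanSpace ℂ (Fin k)))
    (h : ∀ i j p q, a i j (EuclideanSpace.single q 1) p = b p q (EuclideanSpace.single j 1) i) :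
    ‖blockOp a‖ = ‖blockOp b‖ :=
  le_antisymm (norm_blockOp_flip_le a b h) (norm_blockOp_flip_le b a fun p q i j => (h i j p q).symm)

end Flip

/-! ### Complete boundedness on finite-dimensional spaces -/

section FiniteDimensional

variable {H : Type*} [NormedAddCommGroup H] [InnerProductSpace ℂ H] {k : ℕ}

/-- Bounded functionals are completely bounded, with the same bound. -/
lemma norm_scalarMul_map_le {V : Submodule ℂ (H →L[ℂ] H)} (f : V →ₗ[ℂ] ℂ) {M : ℝ} (hM : 0 ≤ M)
    (hf : ∀ x, ‖f x‖ ≤ M * ‖x‖) (a : Matrix (Fin k) (Fin k) V) (x : EuclideanSpace ℂ (Fin k)) :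
    ‖scalarMul (a.map f) x‖ ≤ M * ‖blockOp (a.map V.subtype)‖ * ‖x‖ := by
  set y : EuclideanSpace ℂ (Fin k) := scalarMul (a.map f) x with hy
  -- With the columns y and x, the sandwich is a single element y* a x of V, of norm at most
  -- ‖y‖‖x‖‖a‖, and f takes the value ‖y‖² there.
  let B : Matrix (Fin k) (Fin 1) ℂ := Matrix.of fun i _ => y i
  let A : Matrix (Fin k) (Fin 1) ℂ := Matrix.of fun i _ => x i
  have col : ∀ (z : EuclideanSpace ℂ (Fin k)) (t : EuclideanSpace ℂ (Fin 1)),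
      ‖scalarMul (Matrix.of fun i _ => z i : Matrix (Fin k) (Fin 1) ℂ) t‖ ≤ ‖z‖ * ‖t‖ := by
    intro z t
    have h1 : scalarMul (Matrix.of fun i _ => z i : Matrix (Fin k) (Fin 1) ℂ) t = t 0 • z := by
      ext i
      simp [scalarMul, mul_comm]
    have h2 : ‖t‖ = ‖t 0‖ := by simp [EuclideanSpace.norm_eq]
    rw [h1, norm_smul, h2, mul_comm]
  have h1 : f (sandwich B A a 0 0) = (‖y‖ ^ 2 : ℝ) := by
    have h2 : inner ℂ y y = ((‖y‖ ^ 2 : ℝ) : ℂ) := by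
      rw [inner_self_eq_norm_sq_to_K]; simp
    rw [← h2]
    conv_rhs => rw [PiLp.inner_apply]
    simp only [sandwich, Matrix.of_apply, map_sum, map_smul, smul_eq_mul, B, A]
    refine Finset.sum_congr rfl fun i _ => ?_
    have h3 : y i = ∑ j, f (a i j) * x j := by simp [hy, scalarMul]
    rw [RCLike.inner_apply]
    simp only [RCLike.star_def]
    generalize (starRingEnd ℂ) (y.ofLp i) = z
    rw [h3, Finset.sum_mul]
    refine Finset.sum_congr rfl fun j _ => ?_
    ring
  have h2 : ‖sandwich B A a 0 0‖ ≤ ‖y‖ * ‖x‖ * ‖blockOp (a.map V.subtype)‖ := by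
    refine le_trans ?_ (norm_blockOp_sandwich_le (norm_nonneg y) (norm_nonneg x) (col y) (col x) _)
    refine le_trans ?_ (norm_entry_le _ 0 0)
    rw [← sandwich_map]
    rfl
  have h3 := hf (sandwich B A a 0 0)
  rw [h1, Complex.norm_real, norm_pow, norm_norm] at h3
  rcases eq_or_lt_of_le (norm_nonneg y) with h0 | h0
  · rw [← h0]; positivity
  · have h4 : ‖y‖ * ‖y‖ ≤ M * ‖blockOp (a.map V.subtype)‖ * ‖x‖ * ‖y‖ := by
      calc ‖y‖ * ‖y‖ = ‖y‖ ^ 2 := by ring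
        _ ≤ _ := h3
        _ ≤ M * (‖y‖ * ‖x‖ * ‖blockOp (a.map V.subtype)‖) := by gcongr
        _ = _ := by ring
    exact le_of_mul_le_mul_right h4 h0

lemma norm_blockOp_smul_le {H' : Type*} [NormedAddCommGroup H'] [InnerProductSpace ℂ H']
    (α : Matrix (Fin k) (Fin k) ℂ) {M : ℝ} (hM : 0 ≤ M)
    (hα : ∀ x : EuclideanSpace ℂ (Fin k), ‖scalarMul α x‖ ≤ M * ‖x‖) (T : H' →L[ℂ] H') :
    ‖blockOp (α.map fun c => c • T)‖ ≤ M * ‖T‖ := by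
  refine ContinuousLinearMap.opNorm_le_bound _ (by positivity) fun ξ => ?_
  have h1 : blockOp (α.map fun c => c • T) ξ = scalarMul α (WithLp.toLp 2 fun i => T (ξ i)) := by
    ext i
    simp [blockOp_apply, scalarMul]
  rw [h1, mul_assoc]
  exact (norm_scalarMul_le hM hα _).trans
    (mul_le_mul_of_nonneg_left (norm_toLp_map_le T ξ) hM)

lemma exists_norm_apply_le {W W' : Type*} [NormedAddCommGroup W] [NormedSpace ℂ W]
    [FiniteDimensional ℂ W] [NormedAddCommGroup W'] [NormedSpace ℂ W'] (f : W →ₗ[ℂ] W') :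
    ∃ M : ℝ, 0 ≤ M ∧ ∀ x, ‖f x‖ ≤ M * ‖x‖ :=
  ⟨‖(LinearMap.toContinuousLinearMap f : W →L[ℂ] W')‖, norm_nonneg _, fun x =>
    (LinearMap.toContinuousLinearMap f).le_opNorm x⟩

/-- A linear map on a finite-dimensional operator space is completely bounded, with a bound linear
in the norms of the images of a basis. -/
lemma exists_norm_blockOp_map_le {ι : Type*} [Fintype ι] {V : Submodule ℂ (H →L[ℂ] H)}
    [FiniteDimensional ℂ V] (b : Module.Basis ι ℂ V) :
    ∃ C : ℝ, 0 ≤ C ∧ ∀ {H' : Type v} [NormedAddCommGroup H'] [InnerProductSpace ℂ H']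
      (ψ : V →ₗ[ℂ] (H' →L[ℂ] H')) {k : ℕ} (a : Matrix (Fin k) (Fin k) V),
      ‖blockOp (a.map ψ)‖ ≤ C * (∑ l, ‖ψ (b l)‖) * ‖blockOp (a.map V.subtype)‖ := by
  choose f hf0 hf using fun l => exists_norm_apply_le (b.coord l)
  refine ⟨∑ l, f l, Finset.sum_nonneg fun l _ => hf0 l, fun {H'} _ _ ψ k a => ?_⟩
  -- ψ is a sum of rank one maps x ↦ b_l*(x) ψ(b_l); the constants come from the coordinate
  -- functionals and do not depend on ψ.
  have h1 : a.map ψ = ∑ l, (a.map (b.coord l)).map fun c => c • ψ (b l) := by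
    ext1 i j
    rw [Matrix.sum_apply]
    conv_lhs => rw [Matrix.map_apply, ← b.sum_repr (a i j), map_sum]
    simp
  rw [h1, blockOp_sum, Finset.mul_sum, Finset.sum_mul]
  refine (norm_sum_le Finset.univ
    fun l => blockOp ((a.map (b.coord l)).map fun c => c • ψ (b l))).trans (Finset.sum_le_sum fun l _ => ?_)
  have h2 := norm_blockOp_smul_le (a.map (b.coord l)) 
    (mul_nonneg (hf0 l) (norm_nonneg (blockOp (a.map V.subtype))))
    (norm_scalarMul_map_le (b.coord l) (hf0 l) (hf l) a)
    (ψ (b l))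
  refine h2.trans ?_
  calc _ = f l * ‖ψ (b l)‖ * ‖blockOp (a.map V.subtype)‖ := by ring
    _ ≤ _ := by
      gcongr
      exact Finset.single_le_sum (f := f) (fun l _ => hf0 l) (Finset.mem_univ l)

end FiniteDimensional

/-- The matrix norms of a vector space are finite-valued norms. -/
class LawfulMatrixNorm (X : Type*) [AddCommGroup X] [Module ℂ X] [MatrixNorm X] : Prop where
  mnorm_smul : ∀ {k : ℕ} (c : ℂ) (a : Matrix (Fin k) (Fin k) X), mnorm k (c • a) = ‖c‖ₑ * mnorm k a
  mnorm_add_le : ∀ {k : ℕ} (a b : Matrix (Fin k) (Fin k) X), mnorm k (a + b) ≤ mnorm k a + mnorm k b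
  mnorm_ne_top : ∀ {k : ℕ} (a : Matrix (Fin k) (Fin k) X), mnorm k a ≠ ⊤
  eq_zero_of_mnorm : ∀ {k : ℕ} (a : Matrix (Fin k) (Fin k) X), mnorm k a = 0 → a = 0

open LawfulMatrixNorm

lemma mnorm_zero {X : Type*} [AddCommGroup X] [Module ℂ X] [MatrixNorm X] [LawfulMatrixNorm X]
    {k : ℕ} : mnorm k (0 : Matrix (Fin k) (Fin k) X) = 0 := by
  have := mnorm_smul (0 : ℂ) (0 : Matrix (Fin k) (Fin k) X)
  simpa using this

instance {H : Type*} [NormedAddCommGroup H] [InnerProductSpace ℂ H] :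
    LawfulMatrixNorm (H →L[ℂ] H) where
  mnorm_smul c a := by
    rw [mnorm_eq_enorm_blockOp, mnorm_eq_enorm_blockOp, ← ofReal_norm, ← ofReal_norm, ← ofReal_norm,
      norm_blockOp_smul, ENNReal.ofReal_mul (norm_nonneg _)]
  mnorm_add_le a b := by
    rw [mnorm_eq_enorm_blockOp, mnorm_eq_enorm_blockOp, mnorm_eq_enorm_blockOp, ← ofReal_norm,
      ← ofReal_norm, ← ofReal_norm, ← ENNReal.ofReal_add (norm_nonneg (blockOp a))
      (norm_nonneg (blockOp b))]
    exact ENNReal.ofReal_le_ofReal (norm_blockOp_add_le a b)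
  mnorm_ne_top a := by rw [mnorm_eq_enorm_blockOp, ← ofReal_norm]; exact ENNReal.ofReal_ne_top
  eq_zero_of_mnorm a h := by
    rw [mnorm_eq_enorm_blockOp, ← ofReal_norm, ENNReal.ofReal_eq_zero] at h
    exact eq_zero_of_norm_blockOp (le_antisymm h (norm_nonneg (blockOp a)))

instance {X : Type*} [AddCommGroup X] [Module ℂ X] [MatrixNorm X] [LawfulMatrixNorm X]
    (V : Submodule ℂ X) : LawfulMatrixNorm V where
  mnorm_smul c a := mnorm_smul c (a.map fun x : V => (x : X))
  mnorm_add_le a b := mnorm_add_le (a.map fun x : V => (x : X)) (b.map fun x : V => (x : X))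
  mnorm_ne_top a := mnorm_ne_top (a.map fun x : V => (x : X))
  eq_zero_of_mnorm a h := by
    have h1 := eq_zero_of_mnorm (a.map fun x : V => (x : X)) h
    ext i j
    exact congrFun (congrFun h1 i) j

section MapMatrix

variable {X Y : Type*} [AddCommGroup X] [Module ℂ X] [AddCommGroup Y] [Module ℂ Y] {k : ℕ}

lemma map_smul_matrix (u : X →ₗ[ℂ] Y) (c : ℂ) (a : Matrix (Fin k) (Fin k) X) :
    (c • a).map u = c • a.map u := by
  ext i j; simp

end MapMatrix

/-! ### Calculus of cb norms and of the distances -/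

section CbNorm

variable {X Y Z : Type*} [AddCommGroup X] [Module ℂ X] [MatrixNorm X]
  [AddCommGroup Y] [Module ℂ Y] [MatrixNorm Y] [AddCommGroup Z] [Module ℂ Z] [MatrixNorm Z]
  {k : ℕ}

lemma cbNorm_le {u : X →ₗ[ℂ] Y} {C : ℝ≥0∞}
    (h : ∀ (k : ℕ) (a : Matrix (Fin k) (Fin k) X), mnorm k (a.map u) ≤ C * mnorm k a) :
    cbNorm u ≤ C := by
  refine iSup_le fun k => iSup_le fun a => iSup_le fun ha => (h k a).trans ?_
  calc C * mnorm k a ≤ C * 1 := by gcongr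
    _ = C := mul_one C

lemma mnorm_map_le_of_forall_le_one [LawfulMatrixNorm X] [LawfulMatrixNorm Y] {u : X →ₗ[ℂ] Y}
    {C : ℝ≥0∞} (h : ∀ a : Matrix (Fin k) (Fin k) X, mnorm k a ≤ 1 → mnorm k (a.map u) ≤ C)
    (a : Matrix (Fin k) (Fin k) X) : mnorm k (a.map u) ≤ C * mnorm k a := by
  rcases eq_or_ne (mnorm k a) 0 with h0 | h0
  · rw [eq_zero_of_mnorm a h0]
    have : (0 : Matrix (Fin k) (Fin k) X).map u = 0 := by ext i j; simp
    rw [this, mnorm_zero]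
    exact bot_le
  have ht := mnorm_ne_top a
  set c : ℂ := (((mnorm k a).toReal⁻¹ : ℝ) : ℂ) with hc
  have hce : ‖c‖ₑ = (mnorm k a)⁻¹ := by
    rw [← ofReal_norm, hc, Complex.norm_real, Real.norm_of_nonneg (by positivity),
      ENNReal.ofReal_inv_of_pos (ENNReal.toReal_pos h0 ht), ENNReal.ofReal_toReal ht]
  have h1 := h (c • a) (by rw [mnorm_smul, hce, ENNReal.inv_mul_cancel h0 ht])
  rw [map_smul_matrix, mnorm_smul, hce, mul_comm] at h1
  rwa [← div_eq_mul_inv, ENNReal.div_le_iff h0 ht] at h1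

lemma mnorm_map_le [LawfulMatrixNorm X] [LawfulMatrixNorm Y] (u : X →ₗ[ℂ] Y)
    (a : Matrix (Fin k) (Fin k) X) : mnorm k (a.map u) ≤ cbNorm u * mnorm k a :=
  mnorm_map_le_of_forall_le_one
    (fun a ha => le_iSup₂_of_le k a (le_iSup (fun _ : mnorm k a ≤ 1 => mnorm k (a.map u)) ha)) a

lemma cbNorm_comp_le [LawfulMatrixNorm X] [LawfulMatrixNorm Y] [LawfulMatrixNorm Z]
    (v : Y →ₗ[ℂ] Z) (u : X →ₗ[ℂ] Y) : cbNorm (v ∘ₗ u) ≤ cbNorm v * cbNorm u := by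
  refine cbNorm_le fun k a => ?_
  have : a.map (v ∘ₗ u) = (a.map u).map v := by ext i j; simp
  rw [this, mul_assoc]
  exact (mnorm_map_le v _).trans (mul_le_mul_right (mnorm_map_le u a) _)

lemma one_le_cbNorm_mul [LawfulMatrixNorm X] [LawfulMatrixNorm Y] [Nontrivial X] (u : X ≃ₗ[ℂ] Y) :
    1 ≤ cbNorm (u : X →ₗ[ℂ] Y) * cbNorm (u.symm : Y →ₗ[ℂ] X) := by
  obtain ⟨x, hx⟩ := exists_ne (0 : X)
  let a : Matrix (Fin 1) (Fin 1) X := Matrix.of fun _ _ => x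
  have ha : mnorm 1 a ≠ 0 := fun h => hx (congrFun (congrFun (eq_zero_of_mnorm a h) 0) 0)
  have h1 := mnorm_map_le (u.symm : Y →ₗ[ℂ] X) (a.map (u : X →ₗ[ℂ] Y))
  have h2 : (a.map (u : X →ₗ[ℂ] Y)).map (u.symm : Y →ₗ[ℂ] X) = a := by ext i j; simp
  rw [h2] at h1
  have h3 := h1.trans (mul_le_mul_right (mnorm_map_le (u : X →ₗ[ℂ] Y) a) _)
  rw [← mul_assoc, mul_comm (cbNorm _)] at h3
  by_contra! h4
  have h5 := ENNReal.mul_lt_mul_left ha (mnorm_ne_top a) h4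
  rw [one_mul] at h5
  exact absurd h3 (not_le.mpr h5)

lemma one_le_dcb [LawfulMatrixNorm X] [LawfulMatrixNorm Y] [Nontrivial X] : 1 ≤ dcb X Y :=
  le_iInf one_le_cbNorm_mul

lemma one_le_dSK [LawfulMatrixNorm X] [Nontrivial X] : 1 ≤ dSK X :=
  le_iInf fun _ => le_iInf fun _ => le_iInf fun _ => one_le_dcb

/-- Strict bounds supply actual isomorphisms to compose, and avoid a product of infima in [0, ∞]. -/
lemma dcb_trans_lt [LawfulMatrixNorm X] [LawfulMatrixNorm Y] [LawfulMatrixNorm Z] {A B : ℝ≥0∞}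
    (h₁ : dcb X Y < A) (h₂ : dcb Y Z < B) : dcb X Z ≤ A * B := by
  obtain ⟨u, hu⟩ := iInf_lt_iff.mp h₁
  obtain ⟨v, hv⟩ := iInf_lt_iff.mp h₂
  refine (iInf_le _ (u.trans v)).trans ?_
  have h3 := cbNorm_comp_le (v : Y →ₗ[ℂ] Z) (u : X →ₗ[ℂ] Y)
  have h4 := cbNorm_comp_le (u.symm : Y →ₗ[ℂ] X) (v.symm : Z →ₗ[ℂ] Y)
  refine (mul_le_mul' h3 h4).trans ?_
  calc _ = (cbNorm (u : X →ₗ[ℂ] Y) * cbNorm (u.symm : Y →ₗ[ℂ] X)) *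
        (cbNorm (v : Y →ₗ[ℂ] Z) * cbNorm (v.symm : Z →ₗ[ℂ] Y)) := by ring
    _ ≤ A * B := mul_le_mul' hu.le hv.le

lemma dSK_le_dcb [LawfulMatrixNorm X] [LawfulMatrixNorm Y] (h : dSK Y ≤ 1) : dSK X ≤ dcb X Y := by
  rw [← mul_one (dcb X Y)]
  refine ENNReal.le_mul_of_forall_lt (by simp) (by simp) fun A hA B hB => ?_
  have h1 := h.trans_lt hB
  simp only [dSK, iInf_lt_iff] at h1
  obtain ⟨F, hF, hK, h1⟩ := h1
  exact (iInf₂_le F hF).trans ((iInf_le _ hK).trans (dcb_trans_lt hA h1))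

/-- The seminorm on `k × k` matrices. -/
noncomputable def mnormSeminorm (X : Type*) [AddCommGroup X] [Module ℂ X] [MatrixNorm X]
    [LawfulMatrixNorm X] (k : ℕ) : Seminorm ℂ (Matrix (Fin k) (Fin k) X) :=
  Seminorm.of (fun a => (mnorm k a).toReal)
    (fun a b => by
      rw [← ENNReal.toReal_add (mnorm_ne_top a) (mnorm_ne_top b)]
      exact ENNReal.toReal_mono (ENNReal.add_ne_top.mpr ⟨mnorm_ne_top a, mnorm_ne_top b⟩)
        (mnorm_add_le a b))
    (fun c a => by rw [mnorm_smul, ENNReal.toReal_mul, toReal_enorm])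

end CbNorm

/-! ### Matrix norms of the dual -/

section Dual

variable {H : Type*} [NormedAddCommGroup H] [InnerProductSpace ℂ H] {V : Submodule ℂ (H →L[ℂ] H)}
  {k : ℕ}

lemma mnorm_opDual (f : Matrix (Fin k) (Fin k) (OpDual V)) :
    mnorm k f = cbNorm (OpDual.toMap f) := rfl

lemma toMap_smul (c : ℂ) (f : Matrix (Fin k) (Fin k) (OpDual V)) :
    OpDual.toMap (c • f) = c • OpDual.toMap f := by
  ext1 x
  change Matrix.toEuclideanCLM (n := Fin k) (𝕜 := ℂ) _ = c • Matrix.toEuclideanCLM (n := Fin k) (𝕜 := ℂ) _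
  rw [← map_smul]
  rfl

lemma toMap_add (f g : Matrix (Fin k) (Fin k) (OpDual V)) :
    OpDual.toMap (f + g) = OpDual.toMap f + OpDual.toMap g := by
  ext1 x
  change Matrix.toEuclideanCLM (n := Fin k) (𝕜 := ℂ) _ =
    Matrix.toEuclideanCLM (n := Fin k) (𝕜 := ℂ) _ + Matrix.toEuclideanCLM (n := Fin k) (𝕜 := ℂ) _
  rw [← map_add]
  rfl

lemma toMap_apply_single (f : Matrix (Fin k) (Fin k) (OpDual V)) (x : V) (i j : Fin k) :
    OpDual.toMap f x (EuclideanSpace.single j 1) i = (f i j).toCLM x := by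
  change Matrix.toEuclideanCLM (n := Fin k) (𝕜 := ℂ) _ _ i = _
  simp [Matrix.ofLp_toEuclideanCLM]

lemma cbNorm_smul {X Y : Type*} [AddCommGroup X] [Module ℂ X] [MatrixNorm X]
    [AddCommGroup Y] [Module ℂ Y] [MatrixNorm Y] [LawfulMatrixNorm Y] (c : ℂ) (u : X →ₗ[ℂ] Y) :
    cbNorm (c • u) = ‖c‖ₑ * cbNorm u := by
  simp only [cbNorm, ENNReal.mul_iSup]
  refine iSup_congr fun k => iSup_congr fun a => iSup_congr fun _ => ?_
  rw [← mnorm_smul]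
  rfl

lemma cbNorm_add_le {X Y : Type*} [AddCommGroup X] [Module ℂ X] [MatrixNorm X]
    [AddCommGroup Y] [Module ℂ Y] [MatrixNorm Y] [LawfulMatrixNorm Y] (u v : X →ₗ[ℂ] Y) :
    cbNorm (u + v) ≤ cbNorm u + cbNorm v := by
  refine iSup_le fun k => iSup_le fun a => iSup_le fun ha => ?_
  have h1 : a.map (u + v) = a.map u + a.map v := by ext i j; simp
  rw [h1]
  exact (mnorm_add_le _ _).trans (add_le_add (le_iSup₂_of_le k a (le_iSup_of_le ha le_rfl))
    (le_iSup₂_of_le k a (le_iSup_of_le ha le_rfl)))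

lemma cbNorm_ne_top {H' : Type*} [NormedAddCommGroup H'] [InnerProductSpace ℂ H']
    [FiniteDimensional ℂ V] (ψ : V →ₗ[ℂ] (H' →L[ℂ] H')) : cbNorm ψ ≠ ⊤ := by
  obtain ⟨C, hC, h⟩ := exists_norm_blockOp_map_le (Module.finBasis ℂ V)
  refine ne_top_of_le_ne_top
    (ENNReal.ofReal_ne_top (r := C * ∑ l, ‖ψ (Module.finBasis ℂ V l)‖)) (cbNorm_le fun k a => ?_)
  rw [mnorm_coe, mnorm_le_mul_iff (by positivity)]
  exact h ψ a

instance [FiniteDimensional ℂ V] : LawfulMatrixNorm (OpDual V) where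
  mnorm_smul c f := by rw [mnorm_opDual, toMap_smul, cbNorm_smul]; rfl
  mnorm_add_le f g := by rw [mnorm_opDual, toMap_add]; exact cbNorm_add_le _ _
  mnorm_ne_top f := cbNorm_ne_top _
  eq_zero_of_mnorm f h := by
    ext1 i j
    refine ContinuousLinearMap.ext fun x => ?_
    have h1 := mnorm_map_le (OpDual.toMap f) (Matrix.of fun _ _ : Fin 1 => x)
    rw [← mnorm_opDual, h, zero_mul, nonpos_iff_eq_zero] at h1
    have h2 := congrFun (congrFun (eq_zero_of_mnorm _ h1) 0) 0
    have h3 : OpDual.toMap f x = 0 := h2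
    have h4 := toMap_apply_single f x i j
    rw [h3] at h4
    exact h4.symm

end Dual

/-! ### Pointwise convergence of seminorms is uniform -/

section Seminorm

/-- A net argument: convergence on a basis makes the q i eventually Lipschitz with a common constant
K, and the unit ball has a finite r-net on which convergence is simultaneous. -/
lemma eventually_norm_le {V ι : Type*} [NormedAddCommGroup V] [NormedSpace ℂ V]
    [FiniteDimensional ℂ V] {L : Filter ι} {q : ι → Seminorm ℂ V}
    (h : ∀ x, Tendsto (fun i => q i x) L (𝓝 ‖x‖)) {ε : ℝ} (hε : 0 < ε) :
    ∀ᶠ i in L, ∀ x, ‖x‖ ≤ (1 + ε) * q i x := by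
  have : ProperSpace V := FiniteDimensional.proper ℂ V
  let b := Module.finBasis ℂ V
  choose M hM0 hM using fun l => exists_norm_apply_le (b.coord l)
  have hb : ∀ᶠ i in L, ∀ l, q i (b l) ≤ ‖b l‖ + 1 := by
    rw [eventually_all]
    exact fun l => (h (b l)).eventually (eventually_le_nhds (lt_add_one _))
  set K := ∑ l, M l * (‖b l‖ + 1) with hK
  have hK0 : 0 ≤ K := Finset.sum_nonneg fun l _ => mul_nonneg (hM0 l) (by positivity)
  have hLip : ∀ᶠ i in L, ∀ x, q i x ≤ K * ‖x‖ := by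
    filter_upwards [hb] with i hi x
    conv_lhs => rw [← b.sum_repr x]
    refine (Finset.le_sum_of_subadditive (q i) (map_zero (q i)).le (map_add_le_add (q i)) _ _).trans ?_
    rw [hK, Finset.sum_mul]
    refine Finset.sum_le_sum fun l _ => ?_
    rw [map_smul_eq_mul]
    calc ‖b.repr x l‖ * q i (b l) ≤ (M l * ‖x‖) * (‖b l‖ + 1) :=
          mul_le_mul (hM l x) (hi l) (apply_nonneg _ _) (mul_nonneg (hM0 l) (norm_nonneg _))
      _ = _ := by ring
  -- Chosen so that (1 + ε)(1 - δ) = 1. Passing from x to the net costs r for ‖y‖, r for the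
  -- convergence at y and K r for q i, hence r = δ / (K + 2).
  set δ := ε / (1 + ε) with hδ
  have hδ0 : 0 < δ := by positivity
  set r := δ / (K + 2) with hr
  have hr0 : 0 < r := by positivity
  obtain ⟨t, -, htf, ht⟩ := (isCompact_closedBall (0 : V) 1).finite_cover_balls hr0
  have hnet : ∀ᶠ i in L, ∀ y ∈ t, ‖y‖ - r ≤ q i y := by
    rw [htf.eventually_all]
    exact fun y _ => (h y).eventually (eventually_ge_nhds (by linarith))
  filter_upwards [hLip, hnet] with i h1 h2
  have key : ∀ x, ‖x‖ = 1 → 1 ≤ (1 + ε) * q i x := by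
    intro x hx
    have hx' : x ∈ Metric.closedBall (0 : V) 1 := by simp [hx]
    obtain ⟨y, hy, hxy⟩ := Set.mem_iUnion₂.mp (ht hx')
    have h3 : ‖x - y‖ ≤ r := by
      rw [← dist_eq_norm]; exact (Metric.mem_ball.mp hxy).le
    have h4 : ‖x‖ - r ≤ ‖y‖ := by linarith [norm_sub_norm_le x y]
    have h5 : q i y ≤ q i x + K * r := by
      have h6 : q i (y - x) ≤ K * r := (h1 _).trans (by rw [norm_sub_rev]; gcongr)
      have h7 : q i y ≤ q i (y - x) + q i x := by
        simpa using map_add_le_add (q i) (y - x) x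
      linarith
    have h8 : r * (K + 2) = δ := by rw [hr, div_mul_cancel₀]; positivity
    have h9 : 1 - δ ≤ q i x := by
      have := h2 y hy
      nlinarith
    have h10 : (1 + ε) * (1 - δ) = 1 := by rw [hδ]; field_simp; ring
    exact h10.symm.le.trans (mul_le_mul_of_nonneg_left h9 (by positivity))
  intro x
  rcases eq_or_ne x 0 with rfl | hx
  · simp
  have hx0 : ‖x‖ ≠ 0 := norm_ne_zero_iff.mpr hx
  have h3 := key (((‖x‖⁻¹ : ℝ) : ℂ) • x) (by rw [norm_smul]; simp [hx0])
  rw [map_smul_eq_mul, Complex.norm_real, norm_inv, norm_norm] at h3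
  have h4 := mul_le_mul_of_nonneg_left h3 (norm_nonneg x)
  calc ‖x‖ = ‖x‖ * 1 := (mul_one _).symm
    _ ≤ _ := h4
    _ = _ := by field_simp

/-- Seminorms on a finite-dimensional space that converge pointwise to a norm converge
uniformly. -/
lemma eventually_seminorm_le {V ι : Type*} [AddCommGroup V] [Module ℂ V]
    [FiniteDimensional ℂ V] {L : Filter ι} {p : Seminorm ℂ V} {q : ι → Seminorm ℂ V}
    (hp : ∀ x, p x = 0 → x = 0) (h : ∀ x, Tendsto (fun i => q i x) L (𝓝 (p x))) {ε : ℝ}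
    (hε : 0 < ε) : ∀ᶠ i in L, ∀ x, p x ≤ (1 + ε) * q i x := by
  let : Norm V := ⟨p⟩
  have core : NormedSpace.Core ℂ V :=
    { norm_nonneg := fun x => apply_nonneg p x
      norm_smul := fun c x => map_smul_eq_mul p c x
      norm_triangle := fun x y => map_add_le_add p x y
      norm_eq_zero_iff := fun x => ⟨hp x, fun hx => by rw [hx]; exact map_zero p⟩ }
  let : NormedAddCommGroup V := NormedAddCommGroup.ofCore core
  let : NormedSpace ℂ V := NormedSpace.ofCore core
  exact eventually_norm_le h hε

end Seminorm

/-! ### Compact operators and matrix algebras -/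

section CompactApproximation

/-- S is spanned by a finite δ-net of the image of the unit ball, and orthogonal projection is the
best approximation. Allowing any S' above S lets several operators share one subspace. -/
lemma exists_finiteDimensional_norm_sub_le {H : Type*} [NormedAddCommGroup H]
    [InnerProductSpace ℂ H] {T : H →L[ℂ] H} (hT : IsCompactOperator T) {δ : ℝ}
    (hδ : 0 < δ) : ∃ S : Submodule ℂ H, FiniteDimensional ℂ S ∧
      ∀ (S' : Submodule ℂ H) [S'.HasOrthogonalProjection], S ≤ S' →
        ∀ x, ‖T x - S'.starProjection (T x)‖ ≤ δ * ‖x‖ := by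
  obtain ⟨t, -, htf, ht⟩ :=
    (hT.isCompact_closure_image_closedBall 1).finite_cover_balls hδ
  refine ⟨Submodule.span ℂ t, FiniteDimensional.span_of_finite ℂ htf, fun S' _ hS x => ?_⟩
  have key : ∀ x, ‖x‖ = 1 → ‖T x - S'.starProjection (T x)‖ ≤ δ := by
    intro x hx
    have hx' : T x ∈ closure (T '' Metric.closedBall 0 1) :=
      subset_closure ⟨x, by simp [hx], rfl⟩
    obtain ⟨y, hy, hxy⟩ := Set.mem_iUnion₂.mp (ht hx')
    rw [S'.starProjection_minimal (T x)]
    refine (ciInf_le ⟨0, ?_⟩ (⟨y, hS (Submodule.subset_span hy)⟩ : S')).trans ?_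
    · rintro _ ⟨z, rfl⟩
      exact norm_nonneg _
    · rw [← dist_eq_norm]
      exact (Metric.mem_ball.mp hxy).le
  rcases eq_or_ne x 0 with rfl | hx
  · simp
  have hx0 : ‖x‖ ≠ 0 := norm_ne_zero_iff.mpr hx
  have h1 := key (((‖x‖⁻¹ : ℝ) : ℂ) • x) (by rw [norm_smul]; simp [hx0])
  rw [map_smul, map_smul, ← smul_sub, norm_smul, Complex.norm_real, norm_inv, norm_norm,
    inv_mul_le_iff₀ (by positivity)] at h1
  rwa [mul_comm]

variable {H : Type*} [NormedAddCommGroup H] [InnerProductSpace ℂ H] [CompleteSpace H]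

/-- Finitely many compact operators are almost supported on a finite-dimensional subspace. -/
lemma exists_finiteDimensional_norm_sub_compress_le {ι : Type*} [Finite ι] {T : ι → H →L[ℂ] H}
    (hT : ∀ l, IsCompactOperator (T l)) {δ : ℝ} (hδ : 0 < δ) :
    ∃ (P : Submodule ℂ H) (_ : FiniteDimensional ℂ P),
      ∀ l, ‖T l - P.starProjection ∘L T l ∘L P.starProjection‖ ≤ 2 * δ := by
  choose S₀ hS₀ hS using fun l => exists_finiteDimensional_norm_sub_le (hT l) hδ
  let S := ⨆ l, S₀ l
  have : FiniteDimensional ℂ S := Submodule.finiteDimensional_iSup _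
  -- Since R contains the T_l* S, the component of T_l y in S vanishes for y orthogonal to P. So
  -- ‖T_l y‖ ≤ δ‖y‖, and compactness of the adjoints is not needed.
  let R := ⨆ l, S.map (ContinuousLinearMap.adjoint (T l) : H →ₗ[ℂ] H)
  have : FiniteDimensional ℂ R := Submodule.finiteDimensional_iSup _
  let P := S ⊔ R
  refine ⟨P, inferInstance, fun l => ContinuousLinearMap.opNorm_le_bound _ (by positivity)
    fun x => ?_⟩
  have h1 := hS l P ((le_iSup S₀ l).trans le_sup_left) x
  set y := x - P.starProjection x with hy
  have hyx : ‖y‖ ≤ ‖x‖ := by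
    rw [hy, P.starProjection_minimal x]
    refine (ciInf_le ⟨0, ?_⟩ (0 : P)).trans (by simp)
    rintro _ ⟨z, rfl⟩
    exact norm_nonneg _
  have hyP : y ∈ Pᗮ := P.sub_starProjection_mem_orthogonal x
  have hTy : S.starProjection (T l y) = 0 := by
    rw [Submodule.starProjection_apply_eq_zero_iff]
    intro z hz
    rw [← ContinuousLinearMap.adjoint_inner_left]
    exact hyP _ (le_sup_right (a := S) (le_iSup (fun l => S.map
      (ContinuousLinearMap.adjoint (T l) : H →ₗ[ℂ] H)) l ⟨z, hz, rfl⟩))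
  have h2 := hS l S (le_iSup S₀ l) y
  rw [hTy, sub_zero] at h2
  have h3 : T l x - P.starProjection (T l (P.starProjection x))
      = (T l x - P.starProjection (T l x)) + P.starProjection (T l y) := by
    rw [hy, map_sub, map_sub]; abel
  simp only [_root_.sub_apply, ContinuousLinearMap.comp_apply]
  rw [h3]
  calc _ ≤ δ * ‖x‖ + δ * ‖x‖ := by
        refine (norm_add_le _ _).trans (add_le_add h1 ?_)
        refine (P.norm_starProjection_apply_le _).trans (h2.trans ?_)
        gcongr
    _ = _ := by ring

lemma exists_isometry_comp_adjoint_eq (P : Submodule ℂ H) [FiniteDimensional ℂ P] :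
    ∃ (N : ℕ) (W : EuclideanSpace ℂ (Fin N) →L[ℂ] H), ‖W‖ ≤ 1 ∧
      W ∘L ContinuousLinearMap.adjoint W = P.starProjection := by
  let b := stdOrthonormalBasis ℂ P
  let L : EuclideanSpace ℂ (Fin (Module.finrank ℂ P)) →ₗᵢ[ℂ] H :=
    P.subtypeₗᵢ.comp b.repr.symm.toLinearIsometry
  refine ⟨_, L.toContinuousLinearMap, L.norm_toContinuousLinearMap_le, ?_⟩
  ext x
  refine (Submodule.eq_starProjection_of_mem_of_inner_eq_zero ?_ fun w hw => ?_).symm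
  · exact Submodule.coe_mem _
  · obtain ⟨z, rfl⟩ : ∃ z, L z = w := ⟨b.repr ⟨w, hw⟩, by simp [L]⟩
    rw [inner_sub_left, sub_eq_zero]
    change inner ℂ x (L z) = inner ℂ (L _) (L z)
    rw [L.inner_map_map]
    exact (ContinuousLinearMap.adjoint_inner_left L.toContinuousLinearMap z x).symm

/-- A finite-dimensional space of compact operators is almost completely isometric to its
compression to a matrix algebra. -/
lemma exists_compression_of_compact {F : Submodule ℂ (H →L[ℂ] H)} [FiniteDimensional ℂ F]
    (hF : ∀ T ∈ F, IsCompactOperator T) {ε : ℝ} (hε : 0 < ε) :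
    ∃ (N : ℕ) (φ : (H →L[ℂ] H) →ₗ[ℂ] (EuclideanSpace ℂ (Fin N) →L[ℂ] EuclideanSpace ℂ (Fin N))),
      ∀ (k : ℕ) (a : Matrix (Fin k) (Fin k) F),
        ‖blockOp ((a.map F.subtype).map φ)‖ ≤ ‖blockOp (a.map F.subtype)‖ ∧
        ‖blockOp (a.map F.subtype)‖ ≤ (1 + ε) * ‖blockOp ((a.map F.subtype).map φ)‖ := by
  let b := Module.finBasis ℂ F
  obtain ⟨C, hC, hCψ⟩ := exists_norm_blockOp_map_le b
  set η := ε / (1 + ε) with hη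
  have hη0 : 0 < η := by positivity
  let n := Module.finrank ℂ F
  -- This makes C · n · 2δ ≤ η; the added ones keep the denominator positive.
  set δ := η / (2 * (C + 1) * (n + 1)) with hδ
  have hδ0 : 0 < δ := by positivity
  obtain ⟨P, hP, hPT⟩ := exists_finiteDimensional_norm_sub_compress_le
    (fun l => hF (b l) (b l).2) hδ0
  obtain ⟨N, W, hW, hWP⟩ := exists_isometry_comp_adjoint_eq P
  refine ⟨N, compression W W, fun k a => ?_⟩
  refine ⟨norm_blockOp_compression_le_of_norm_le_one hW hW _, ?_⟩
  set φ := compression W W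
  set φ' := compression (ContinuousLinearMap.adjoint W) (ContinuousLinearMap.adjoint W)
  have hφ' : ∀ T, φ' (φ T) = P.starProjection ∘L T ∘L P.starProjection := by
    intro T
    rw [← hWP]
    ext x
    simp [φ, φ', compression]
  -- The defect T ↦ T - PTP is small on a basis, hence has small cb norm.
  let ψ : F →ₗ[ℂ] (H →L[ℂ] H) := F.subtype - φ' ∘ₗ φ ∘ₗ F.subtype
  have hψb : ∑ l, ‖ψ (b l)‖ ≤ n * (2 * δ) := by
    calc ∑ l, ‖ψ (b l)‖ ≤ ∑ _l : Fin n, 2 * δ := by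
          refine Finset.sum_le_sum fun l _ => ?_
          have := hPT l
          rw [← hφ'] at this
          exact this
      _ = _ := by simp
  have h1 := hCψ ψ a
  have h2 : a.map F.subtype = a.map ψ + ((a.map F.subtype).map φ).map φ' := by
    ext1 i j
    simp [ψ]
  have h3 : ‖blockOp (a.map F.subtype)‖ ≤
      ‖blockOp (a.map ψ)‖ + ‖blockOp ((a.map F.subtype).map φ)‖ := by
    conv_lhs => rw [h2]
    refine (norm_blockOp_add_le _ _).trans (add_le_add le_rfl
      (norm_blockOp_compression_le_of_norm_le_one ?_ ?_ _)) <;>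
    rwa [LinearIsometryEquiv.norm_map]
  have h4 : C * (∑ l, ‖ψ (b l)‖) ≤ η := by
    calc C * (∑ l, ‖ψ (b l)‖) ≤ (C + 1) * ((n + 1) * (2 * δ)) := by
          refine mul_le_mul (by linarith) (hψb.trans ?_) (by positivity) (by positivity)
          gcongr
          linarith
      _ = η := by rw [hδ]; field_simp
  have h5 : ‖blockOp (a.map ψ)‖ ≤ η * ‖blockOp (a.map F.subtype)‖ :=
    h1.trans (mul_le_mul_of_nonneg_right h4 (norm_nonneg (blockOp (a.map F.subtype))))
  have h6 : (1 - η) * ‖blockOp (a.map F.subtype)‖ ≤ ‖blockOp ((a.map F.subtype).map φ)‖ := by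
    linarith
  have h7 : (1 + ε) * (1 - η) = 1 := by rw [hη]; field_simp; ring
  calc ‖blockOp (a.map F.subtype)‖ = (1 + ε) * ((1 - η) * ‖blockOp (a.map F.subtype)‖) := by
        rw [← mul_assoc, h7, one_mul]
    _ ≤ _ := by gcongr

/-- A finite-dimensional space with `d_SK(X) < r` embeds in a matrix algebra with distortion
less than `r`. -/
lemma exists_matrix_embedding_of_dSK_lt {X : Type*} [AddCommGroup X] [Module ℂ X] [MatrixNorm X]
    [LawfulMatrixNorm X] [FiniteDimensional ℂ X] [Nontrivial X] {r : ℝ≥0∞} (h : dSK X < r) :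
    ∃ (N : ℕ) (j : X →ₗ[ℂ] (EuclideanSpace ℂ (Fin N) →L[ℂ] EuclideanSpace ℂ (Fin N)))
      (A B : ℝ≥0∞), A ≠ ⊤ ∧ B ≠ ⊤ ∧ A * B < r ∧
      ∀ (k : ℕ) (a : Matrix (Fin k) (Fin k) X),
        mnorm k (a.map j) ≤ A * mnorm k a ∧ mnorm k a ≤ B * mnorm k (a.map j) := by
  simp only [dSK, dcb, iInf_lt_iff] at h
  obtain ⟨F, -, hK, u, hu⟩ := h
  have : FiniteDimensional ℂ F := u.finiteDimensional
  have h1u := one_le_cbNorm_mul u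
  -- An infinite factor would make the product 0 or ∞, but it is at least 1 and less than r.
  have hA : cbNorm (u : X →ₗ[ℂ] F) ≠ ⊤ := fun hA => by
    rw [hA, ENNReal.top_mul' ] at hu h1u
    split_ifs at hu h1u <;> simp at hu h1u
  have hB : cbNorm (u.symm : F →ₗ[ℂ] X) ≠ ⊤ := fun hB => by
    rw [hB, ENNReal.mul_top'] at hu h1u
    split_ifs at hu h1u <;> simp at hu h1u
  set s := cbNorm (u : X →ₗ[ℂ] F) * cbNorm (u.symm : F →ₗ[ℂ] X) with hs
  obtain ⟨ε, hε, hεr⟩ : ∃ ε : ℝ, 0 < ε ∧ s * ENNReal.ofReal (1 + ε) < r := by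
    have h1 : Tendsto (fun ε : ℝ => s * ENNReal.ofReal (1 + ε)) (𝓝[>] 0) (𝓝 s) := by
      have h2 : Tendsto (fun ε : ℝ => ENNReal.ofReal (1 + ε)) (𝓝[>] 0) (𝓝 1) := by
        have : Tendsto (fun ε : ℝ => ENNReal.ofReal (1 + ε)) (𝓝 0) (𝓝 (ENNReal.ofReal (1 + 0))) :=
          (ENNReal.continuous_ofReal.comp (continuous_const.add continuous_id)).tendsto 0
        rw [add_zero, ENNReal.ofReal_one] at this
        exact this.mono_left nhdsWithin_le_nhds
      simpa using ENNReal.Tendsto.const_mul h2 (Or.inl one_ne_zero) (a := s)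
    obtain ⟨ε, h3, h4⟩ := ((h1.eventually (eventually_lt_nhds hu)).and
      self_mem_nhdsWithin).exists
    exact ⟨ε, h4, h3⟩
  obtain ⟨N, φ, hφ⟩ := exists_compression_of_compact hK hε
  refine ⟨N, φ ∘ₗ F.subtype ∘ₗ u, cbNorm (u : X →ₗ[ℂ] F),
    cbNorm (u.symm : F →ₗ[ℂ] X) * ENNReal.ofReal (1 + ε), hA,
    ENNReal.mul_ne_top hB ENNReal.ofReal_ne_top, by rwa [← mul_assoc], fun k a => ?_⟩
  have h1 : a.map (φ ∘ₗ F.subtype ∘ₗ u) = ((a.map (u : X →ₗ[ℂ] F)).map F.subtype).map φ := by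
    ext1 i j; simp
  obtain ⟨h2, h3⟩ := hφ k (a.map (u : X →ₗ[ℂ] F))
  rw [← mnorm_le_iff] at h2
  rw [← mnorm_le_mul_iff (by positivity)] at h3
  rw [h1]
  refine ⟨h2.trans (mnorm_map_le _ a), ?_⟩
  have h4 := mnorm_map_le (u.symm : F →ₗ[ℂ] X) (a.map (u : X →ₗ[ℂ] F))
  have h5 : (a.map (u : X →ₗ[ℂ] F)).map (u.symm : F →ₗ[ℂ] X) = a := by ext i j; simp
  rw [h5] at h4
  rw [mul_assoc]
  exact h4.trans (mul_le_mul_right h3 _)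

end CompactApproximation

/-! ### Direct sums of maps into operator algebras -/

section DirectSum

lemma hasSum_norm_sq {ι : Type*} {G : ι → Type*} [∀ i, NormedAddCommGroup (G i)] (f : lp G 2) : HasSum (fun i => ‖f i‖ ^ 2) (‖f‖ ^ 2) := by
  simpa using lp.hasSum_norm (by norm_num) f

lemma lp_sum_apply {ι κ : Type*} {G : ι → Type*} [∀ i, NormedAddCommGroup (G i)] (s : Finset κ)
    (f : κ → lp G 2) (i : ι) : (∑ j ∈ s, f j) i = ∑ j ∈ s, f j i := by
  rw [lp.coeFn_sum]
  exact Finset.sum_apply _ _ _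

lemma hasSum_norm_sq_toLp {ι : Type*} {G : ι → Type*} [∀ i, NormedAddCommGroup (G i)] {k : ℕ}
    (ξ : PiLp 2 (fun _ : Fin k => lp G 2)) :
    HasSum (fun i => ‖(WithLp.toLp 2 fun p => ξ p i : PiLp 2 (fun _ : Fin k => G i))‖ ^ 2)
      (‖ξ‖ ^ 2) := by
  simp_rw [PiLp.norm_sq_eq_of_L2]
  exact hasSum_sum fun p _ => hasSum_norm_sq (ξ p)

variable {X : Type*} [AddCommGroup X] [Module ℂ X] {ι : Type*} {G : ι → Type*}
  [∀ i, NormedAddCommGroup (G i)] [∀ i, InnerProductSpace ℂ (G i)] {k : ℕ}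

/-- The direct sum of a pointwise bounded family of maps into operator algebras. -/
noncomputable def directSum (φ : ∀ i, X →ₗ[ℂ] (G i →L[ℂ] G i))
    (hφ : ∀ x, ∃ K : ℝ, 0 ≤ K ∧ ∀ i, ‖φ i x‖ ≤ K) : X →ₗ[ℂ] (lp G 2 →L[ℂ] lp G 2) where
  toFun x := lp.mapCLM 2 (fun i => φ i x) (hφ x).choose_spec.1 (hφ x).choose_spec.2
  map_add' x y := by ext; simp
  map_smul' c x := by ext; simp

variable {φ : ∀ i, X →ₗ[ℂ] (G i →L[ℂ] G i)} {hφ : ∀ x, ∃ K : ℝ, 0 ≤ K ∧ ∀ i, ‖φ i x‖ ≤ K}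

lemma directSum_apply (x : X) (f : lp G 2) (i : ι) : directSum φ hφ x f i = φ i x (f i) := by
  simp [directSum]

lemma norm_blockOp_le_directSum (a : Matrix (Fin k) (Fin k) X) (i : ι) :
    ‖blockOp (a.map (φ i))‖ ≤ ‖blockOp (a.map (directSum φ hφ))‖ := by
  classical
  have hn : ∀ ξ : PiLp 2 (fun _ : Fin k => G i),
      ‖(WithLp.toLp 2 fun p => lp.single 2 i (ξ p) : PiLp 2 (fun _ : Fin k => lp G 2))‖ = ‖ξ‖ := by
    intro ξ
    rw [← sq_eq_sq₀ (norm_nonneg _) (norm_nonneg _), PiLp.norm_sq_eq_of_L2, PiLp.norm_sq_eq_of_L2]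
    simp [lp.norm_single]
  refine norm_blockOp_le (norm_nonneg (blockOp (a.map (directSum φ hφ)))) fun ξ η => ?_
  rw [← hn ξ, ← hn η]
  refine le_of_eq_of_le ?_ (norm_sum_inner_le _ _ _)
  congr 1
  refine Finset.sum_congr rfl fun p _ => Finset.sum_congr rfl fun q _ => ?_
  rw [lp.inner_single_left, Matrix.map_apply, Matrix.map_apply, directSum_apply,
    lp.single_apply_self]

lemma norm_blockOp_directSum_le (a : Matrix (Fin k) (Fin k) X) {C : ℝ} (hC : 0 ≤ C)
    (h : ∀ i, ‖blockOp (a.map (φ i))‖ ≤ C) : ‖blockOp (a.map (directSum φ hφ))‖ ≤ C := by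
  refine ContinuousLinearMap.opNorm_le_bound _ hC fun ξ => ?_
  refine abs_le_of_sq_le_sq' ?_ (by positivity) |>.2
  rw [mul_pow]
  refine hasSum_le (fun i => ?_) (hasSum_norm_sq_toLp _) ((hasSum_norm_sq_toLp ξ).mul_left (C ^ 2))
  rw [← mul_pow]
  refine pow_le_pow_left₀ (norm_nonneg _) ?_ 2
  have h1 : (WithLp.toLp 2 fun p => blockOp (a.map (directSum φ hφ)) ξ p i :
      PiLp 2 (fun _ : Fin k => G i)) = blockOp (a.map (φ i)) (WithLp.toLp 2 fun p => ξ p i) := by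
    ext p
    simp only [blockOp_apply, lp_sum_apply, Matrix.map_apply, directSum_apply]
  rw [h1]
  exact ((blockOp (a.map (φ i))).le_opNorm _).trans
    (mul_le_mul_of_nonneg_right (h i) (norm_nonneg _))

lemma mnorm_directSum (a : Matrix (Fin k) (Fin k) X) :
    mnorm k (a.map (directSum φ hφ)) = ⨆ i, mnorm k (a.map (φ i)) := by
  refine le_antisymm ?_ (iSup_le fun i => mnorm_le_iff.mpr (norm_blockOp_le_directSum a i))
  rcases eq_or_ne (⨆ i, mnorm k (a.map (φ i))) ⊤ with h | h
  · rw [h]; exact le_top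
  rw [mnorm_eq_enorm_blockOp, ← ofReal_norm]
  refine ENNReal.ofReal_le_of_le_toReal (norm_blockOp_directSum_le a ENNReal.toReal_nonneg
    fun i => ?_)
  rw [← ENNReal.ofReal_le_iff_le_toReal h]
  refine le_of_eq_of_le (ofReal_norm (blockOp (a.map (φ i)))) ?_
  exact le_iSup (fun i => mnorm k (a.map (φ i))) i

end DirectSum

/-! ### Matrix algebras inside the compact operators -/

section CompactEmbedding

/-- Operators on a finite-dimensional Hilbert space embed completely isometrically in `K(ℓ²)`. -/
lemma exists_compact_embedding (G : Type*) [NormedAddCommGroup G] [InnerProductSpace ℂ G]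
    [FiniteDimensional ℂ G] :
    ∃ j : (G →L[ℂ] G) →ₗ[ℂ] (lp (fun _ : ℕ => ℂ) 2 →L[ℂ] lp (fun _ : ℕ => ℂ) 2),
      (∀ T, IsCompactOperator (j T)) ∧
      ∀ (k : ℕ) (b : Matrix (Fin k) (Fin k) (G →L[ℂ] G)), mnorm k (b.map j) = mnorm k b := by
  have : CompleteSpace G := FiniteDimensional.complete ℂ G
  let e : HilbertBasis ℕ ℂ (lp (fun _ : ℕ => ℂ) 2) := HilbertBasis.ofRepr (.refl ℂ _)
  let b := stdOrthonormalBasis ℂ G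
  have he : Orthonormal ℂ (fun l : Fin (Module.finrank ℂ G) => e l) :=
    e.orthonormal.comp _ Fin.val_injective
  let L : G →ₗᵢ[ℂ] lp (fun _ : ℕ => ℂ) 2 :=
    (b.toBasis.constr ℂ fun l => e l).isometryOfOrthonormal (v := b.toBasis)
      (by simp [b.orthonormal]) (by
        convert he using 1
        ext1 l
        simp)
  let V := L.toContinuousLinearMap
  have hV : ‖V‖ ≤ 1 := L.norm_toContinuousLinearMap_le
  have hVa : ‖ContinuousLinearMap.adjoint V‖ ≤ 1 := by rwa [LinearIsometryEquiv.norm_map]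
  have hVV : ∀ x, ContinuousLinearMap.adjoint V (V x) = x := by
    intro x
    refine ext_inner_left ℂ fun y => ?_
    rw [ContinuousLinearMap.adjoint_inner_right]
    exact L.inner_map_map y x
  -- j is T ↦ V T V*. As V*V = 1, the complete contraction S ↦ V* S V is a left inverse.
  let j := compression (ContinuousLinearMap.adjoint V) (ContinuousLinearMap.adjoint V)
  refine ⟨j, fun T => ?_, fun k c => le_antisymm ?_ ?_⟩
  · have : ProperSpace G := FiniteDimensional.proper ℂ G
    change IsCompactOperator (ContinuousLinearMap.adjoint (ContinuousLinearMap.adjoint V) ∘L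
      (T ∘L ContinuousLinearMap.adjoint V))
    exact (isCompactOperator_of_locallyCompactSpace_rng
      (ContinuousLinearMap.adjoint (ContinuousLinearMap.adjoint V))).comp_clm _
  · exact mnorm_le_iff.mpr (norm_blockOp_compression_le_of_norm_le_one hVa hVa c)
  · have h1 : c = (c.map j).map (compression V V) := by
      ext1 p q
      ext x
      simp [j, compression, hVV]
    conv_lhs => rw [h1]
    exact mnorm_le_iff.mpr (norm_blockOp_compression_le_of_norm_le_one hV hV _)

variable {X : Type*} [AddCommGroup X] [Module ℂ X] [MatrixNorm X] [LawfulMatrixNorm X]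
  [FiniteDimensional ℂ X]

lemma dSK_le_of_embedding {G : Type*} [NormedAddCommGroup G] [InnerProductSpace ℂ G]
    [FiniteDimensional ℂ G] (D : X →ₗ[ℂ] (G →L[ℂ] G)) {A B : ℝ≥0∞}
    (hA : ∀ (k : ℕ) (a : Matrix (Fin k) (Fin k) X), mnorm k (a.map D) ≤ A * mnorm k a)
    (hB : ∀ (k : ℕ) (a : Matrix (Fin k) (Fin k) X), mnorm k a ≤ B * mnorm k (a.map D)) :
    dSK X ≤ A * B := by
  obtain ⟨j, hjc, hj⟩ := exists_compact_embedding G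
  have hmap : ∀ (k : ℕ) (a : Matrix (Fin k) (Fin k) X), a.map (j ∘ₗ D) = (a.map D).map j := by
    intro k a; ext1; simp
  have hinj : Function.Injective (j ∘ₗ D) := by
    rw [← LinearMap.ker_eq_bot, LinearMap.ker_eq_bot']
    intro x hx
    have h1 := hB 1 (Matrix.of fun _ _ => x)
    rw [← hj, ← hmap] at h1
    have h2 : (Matrix.of fun _ _ : Fin 1 => x).map (j ∘ₗ D) = 0 := by
      ext1 p q
      exact hx
    rw [h2, mnorm_zero, mul_zero, nonpos_iff_eq_zero] at h1
    exact congrFun (congrFun (eq_zero_of_mnorm _ h1) 0) 0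
  let F := LinearMap.range (j ∘ₗ D)
  let w : X ≃ₗ[ℂ] F := LinearEquiv.ofInjective (j ∘ₗ D) hinj
  have hF : IsClosed (F : Set (lp (fun _ : ℕ => ℂ) 2 →L[ℂ] lp (fun _ : ℕ => ℂ) 2)) :=
    F.closed_of_finiteDimensional
  have hw : ∀ (k : ℕ) (a : Matrix (Fin k) (Fin k) X),
      mnorm k (a.map (w : X →ₗ[ℂ] F)) = mnorm k (a.map D) := by
    intro k a
    rw [← hj, ← hmap]
    rfl
  refine (iInf₂_le F hF).trans ((iInf_le _ ?_).trans ((iInf_le _ w).trans (mul_le_mul' ?_ ?_)))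
  · rintro _ ⟨x, rfl⟩
    exact hjc _
  · exact cbNorm_le fun k a => (hw k a).trans_le (hA k a)
  · refine cbNorm_le fun k b => ?_
    have h1 : b = (b.map (w.symm : F →ₗ[ℂ] X)).map (w : X →ₗ[ℂ] F) := by ext1; simp
    conv_rhs => rw [h1, hw]
    exact hB k _

end CompactEmbedding

/-! ### Norms defined by maps into matrix algebras of bounded size -/

section Supremum

variable {X : Type*} [AddCommGroup X] [Module ℂ X] [MatrixNorm X] [LawfulMatrixNorm X]
  [FiniteDimensional ℂ X]

/-- If the matrix norms of `X` are the suprema over a family of maps into matrix algebras of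
bounded size, then `d_SK(X) ≤ 1`. -/
lemma dSK_le_one_of_mnorm_eq_iSup {S : Type*} {N : ℕ} {m : S → ℕ} (hm : ∀ s, m s ≤ N)
    (φ : ∀ s, X →ₗ[ℂ] (EuclideanSpace ℂ (Fin (m s)) →L[ℂ] EuclideanSpace ℂ (Fin (m s))))
    (h : ∀ (k : ℕ) (a : Matrix (Fin k) (Fin k) X), mnorm k a = ⨆ s, mnorm k (a.map (φ s))) :
    dSK X ≤ 1 := by
  have hφ : ∀ (J : Finset S) (x : X), ∃ K : ℝ, 0 ≤ K ∧ ∀ s : J, ‖φ s x‖ ≤ K := fun J x =>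
    ⟨∑ s ∈ J, ‖φ s x‖, by positivity, fun s =>
      Finset.single_le_sum (f := fun s => ‖φ s x‖) (fun _ _ => norm_nonneg _) s.2⟩
  let D : ∀ J : Finset S, X →ₗ[ℂ] _ := fun J => directSum (fun s : J => φ s) (hφ J)
  have hD : ∀ J (k : ℕ) (a : Matrix (Fin k) (Fin k) X),
      mnorm k (a.map (D J)) = ⨆ s : J, mnorm k (a.map (φ s)) := fun J k a => mnorm_directSum a
  have hDle : ∀ J (k : ℕ) (a : Matrix (Fin k) (Fin k) X), mnorm k (a.map (D J)) ≤ mnorm k a := by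
    intro J k a
    rw [hD, h]
    exact iSup_le fun s => le_iSup (fun s => mnorm k (a.map (φ s))) s
  have hlim : ∀ a : Matrix (Fin N) (Fin N) X,
      Tendsto (fun J => mnorm N (a.map (D J))) atTop (𝓝 (mnorm N a)) := by
    intro a
    have h1 : mnorm N a = ⨆ J : Finset S, mnorm N (a.map (D J)) := by
      rw [h, iSup_eq_iSup_finset]
      simp_rw [hD, iSup_subtype']
    rw [h1]
    refine tendsto_atTop_iSup fun J J' hJ => ?_
    rw [hD, hD]
    exact iSup_le fun s => le_iSup (fun s : J' => mnorm N (a.map (φ s))) ⟨s, hJ s.2⟩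
  let q : Finset S → Seminorm ℂ (Matrix (Fin N) (Fin N) X) := fun J =>
    (mnormSeminorm _ N).comp (D J).mapMatrix
  have key : ∀ ε : ℝ, 0 < ε → dSK X ≤ ENNReal.ofReal (1 + ε) := by
    intro ε hε
    -- On the finite-dimensional space M_N(X) the norms given by finite subfamilies converge
    -- uniformly, so one finite J nearly attains the supremum.
    obtain ⟨J, hJ⟩ := (eventually_seminorm_le (p := mnormSeminorm X N) (q := q)
      (fun a ha => eq_zero_of_mnorm a
        (((ENNReal.toReal_eq_zero_iff _).mp ha).resolve_right (mnorm_ne_top a)))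
      (fun a => (ENNReal.tendsto_toReal (mnorm_ne_top a)).comp (hlim a)) hε).exists
    have hJ' : ∀ a : Matrix (Fin N) (Fin N) X,
        mnorm N a ≤ ENNReal.ofReal (1 + ε) * mnorm N (a.map (D J)) := by
      intro a
      have h1 : (mnorm N a).toReal ≤ (1 + ε) * (mnorm N (a.map (D J))).toReal := hJ a
      rw [← ENNReal.ofReal_toReal (mnorm_ne_top a), ← ENNReal.ofReal_toReal
        (mnorm_ne_top (a.map (D J))), ← ENNReal.ofReal_mul (by positivity)]
      exact ENNReal.ofReal_le_ofReal h1
    have hfin : ∀ s : J, FiniteDimensional ℂ (EuclideanSpace ℂ (Fin (m s))) := inferInstance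
    have : FiniteDimensional ℂ (lp (fun s : J => EuclideanSpace ℂ (Fin (m s))) 2) :=
      LinearEquiv.finiteDimensional
        (lpPiLpₗᵢ (p := 2) (fun s : J => EuclideanSpace ℂ (Fin (m s))) ℂ).symm.toLinearEquiv
    -- The estimate on N × N matrices passes to all sizes because every φ s takes values in matrices
    -- of size at most N.
    have h2 := dSK_le_of_embedding (D J) (A := 1) (B := ENNReal.ofReal (1 + ε))
      (fun k a => by rw [one_mul]; exact hDle J k a) (fun k a => by
        rw [h]
        refine iSup_le fun s => (mnorm_le_mul_iff (by positivity)).mpr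
          (norm_blockOp_map_le_of_le (hm s) (D J) (φ s) (by positivity) (fun b => ?_) a)
        rw [← mnorm_le_mul_iff (by positivity)]
        refine le_trans ?_ (hJ' b)
        rw [h]
        exact le_iSup (fun s => mnorm N (b.map (φ s))) s)
    rwa [one_mul] at h2
  refine ENNReal.le_of_forall_pos_le_add fun ε hε _ => ?_
  refine (key ε hε).trans_eq ?_
  rw [ENNReal.ofReal_add zero_le_one ε.coe_nonneg]
  simp

end Supremum

section OfMap

variable {E : Type*} [NormedAddCommGroup E] [NormedSpace ℂ E] [FiniteDimensional ℂ E] {k : ℕ}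

instance : FiniteDimensional ℂ (OpDual E) := inferInstanceAs (FiniteDimensional ℂ (E →L[ℂ] ℂ))

/-- Linear functionals on a finite-dimensional space, as elements of the operator space dual. -/
noncomputable def OpDual.ofDual : Module.Dual ℂ E →ₗ[ℂ] OpDual E where
  toFun f := (LinearMap.toContinuousLinearMap f : E →L[ℂ] ℂ)
  map_add' f g := map_add (LinearMap.toContinuousLinearMap (𝕜 := ℂ) (E := E) (F' := ℂ)) f g
  map_smul' c f := map_smul (LinearMap.toContinuousLinearMap (𝕜 := ℂ) (E := E) (F' := ℂ)) c f

lemma OpDual.ext {E : Type*} [NormedAddCommGroup E] [NormedSpace ℂ E] {f g : OpDual E}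
    (h : ∀ x, f.toCLM x = g.toCLM x) : f = g :=
  ContinuousLinearMap.ext h

/-- The `(i, j)` matrix coefficient. -/
noncomputable def matrixCoeff (i j : Fin k) :
    (EuclideanSpace ℂ (Fin k) →L[ℂ] EuclideanSpace ℂ (Fin k)) →ₗ[ℂ] ℂ where
  toFun T := T (EuclideanSpace.single j 1) i
  map_add' S T := by simp
  map_smul' c T := by simp

lemma ext_matrixCoeff {S T : EuclideanSpace ℂ (Fin k) →L[ℂ] EuclideanSpace ℂ (Fin k)}
    (h : ∀ i j, matrixCoeff i j S = matrixCoeff i j T) : S = T := by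
  refine ContinuousLinearMap.coe_injective
    ((EuclideanSpace.basisFun (Fin k) ℂ).toBasis.ext fun j => ?_)
  ext i
  simpa [matrixCoeff] using h i j

/-- The matrix of functionals of a map into a matrix algebra. -/
noncomputable def OpDual.ofMap
    (ψ : E →ₗ[ℂ] (EuclideanSpace ℂ (Fin k) →L[ℂ] EuclideanSpace ℂ (Fin k))) :
    Matrix (Fin k) (Fin k) (OpDual E) :=
  Matrix.of fun i j => OpDual.ofDual (matrixCoeff i j ∘ₗ ψ)

end OfMap

/-! ### Embeddings of the dual as matrices over the space -/

section Duality

variable {H : Type*} [NormedAddCommGroup H] [InnerProductSpace ℂ H] {V : Submodule ℂ (H →L[ℂ] H)}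
  {k N : ℕ}

lemma toMap_ofMap [FiniteDimensional ℂ V]
    (ψ : V →ₗ[ℂ] (EuclideanSpace ℂ (Fin k) →L[ℂ] EuclideanSpace ℂ (Fin k))) :
    OpDual.toMap (OpDual.ofMap (E := V) ψ) = ψ :=
  LinearMap.ext fun x => ext_matrixCoeff fun i j => toMap_apply_single _ x i j

lemma mnorm_flip
    {a : Matrix (Fin k) (Fin k) (EuclideanSpace ℂ (Fin N) →L[ℂ] EuclideanSpace ℂ (Fin N))}
    {b : Matrix (Fin N) (Fin N) (EuclideanSpace ℂ (Fin k) →L[ℂ] EuclideanSpace ℂ (Fin k))}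
    (h : ∀ i j p q, matrixCoeff p q (a i j) = matrixCoeff i j (b p q)) :
    mnorm k a = mnorm N b :=
  le_antisymm (mnorm_le_iff.mpr (norm_blockOp_flip a b h).le)
    (mnorm_le_iff.mpr (norm_blockOp_flip a b h).ge)

/-- The matrix coefficients of j are functionals on the dual, hence elements of V by reflexivity in
finite dimension. -/
lemma exists_matrix_eval [FiniteDimensional ℂ V]
    (j : OpDual V →ₗ[ℂ] (EuclideanSpace ℂ (Fin N) →L[ℂ] EuclideanSpace ℂ (Fin N))) :
    ∃ t : Matrix (Fin N) (Fin N) V,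
      ∀ (f : OpDual V) p q, matrixCoeff p q (j f) = f.toCLM (t p q) := by
  refine ⟨Matrix.of fun p q => (Module.evalEquiv ℂ V).symm (matrixCoeff p q ∘ₗ j ∘ₗ OpDual.ofDual (E := V)),
    fun f p q => ?_⟩
  let ℓ : Module.Dual ℂ V := f.toCLM
  have h1 : OpDual.ofDual (E := V) ℓ = f := OpDual.ext fun x => rfl
  have h2 := congrArg (fun g : Module.Dual ℂ (Module.Dual ℂ V) => g ℓ)
    ((Module.evalEquiv ℂ V).apply_symm_apply (matrixCoeff p q ∘ₗ j ∘ₗ OpDual.ofDual (E := V)))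
  simp only [LinearMap.comp_apply, h1] at h2
  exact h2.symm

variable [CompleteSpace H]

/-- If the dual of `V` embeds in a matrix algebra, then the complete bound of a map on `V` is
controlled by its value at one matrix over `V`. -/
lemma exists_matrix_cbNorm_le [FiniteDimensional ℂ V]
    (j : OpDual V →ₗ[ℂ] (EuclideanSpace ℂ (Fin N) →L[ℂ] EuclideanSpace ℂ (Fin N))) {A B : ℝ≥0∞}
    (hj : ∀ (k : ℕ) (f : Matrix (Fin k) (Fin k) (OpDual V)),
      mnorm k (f.map j) ≤ A * mnorm k f ∧ mnorm k f ≤ B * mnorm k (f.map j)) :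
    ∃ t : Matrix (Fin N) (Fin N) V, mnorm N t ≤ A ∧
      ∀ {H' : Type v} [NormedAddCommGroup H'] [InnerProductSpace ℂ H'] [CompleteSpace H']
        {W : Submodule ℂ (H' →L[ℂ] H')} (u : V →ₗ[ℂ] W), cbNorm u ≤ B * mnorm N (t.map u) := by
  obtain ⟨t, ht⟩ := exists_matrix_eval j
  -- A map ψ into M_k is a k × k matrix over the dual; applying j to it or ψ to t gives the same
  -- element of M_k ⊗ M_N.
  have flip : ∀ (k : ℕ) (ψ : V →ₗ[ℂ] (EuclideanSpace ℂ (Fin k) →L[ℂ] EuclideanSpace ℂ (Fin k))),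
      mnorm k ((OpDual.ofMap (E := V) ψ).map j) = mnorm N (t.map ψ) := fun k ψ =>
    mnorm_flip fun i j p q => by
      rw [Matrix.map_apply, ht]; rfl
  refine ⟨t, ?_, fun {H'} _ _ _ W u => cbNorm_le fun k a => ?_⟩
  · rw [mnorm_coe]
    refine mnorm_le_of_forall_completeContraction _ _ fun φ hφ => ?_
    have h1 : (t.map V.subtype).map φ = t.map (φ ∘ₗ V.subtype) := by ext1; simp
    rw [h1, ← flip]
    refine (hj _ _).1.trans ?_
    rw [mnorm_opDual, toMap_ofMap]
    calc _ ≤ A * 1 := by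
          gcongr
          refine cbNorm_le fun k a => ?_
          have h2 : a.map (φ ∘ₗ V.subtype) = (a.map V.subtype).map φ := by ext1; simp
          rw [h2, one_mul]
          exact hφ k _
      _ = A := mul_one A
  · rw [mnorm_coe]
    -- Composing u with complete contractions into matrix algebras reduces to maps that are matrices
    -- over the dual, to which the lower bound for j applies.
    refine mnorm_le_of_forall_completeContraction _ _ fun φ hφ => ?_
    let ψ := φ ∘ₗ W.subtype ∘ₗ u
    have h1 : ∀ {m : ℕ} (c : Matrix (Fin m) (Fin m) V),
        ((c.map u).map W.subtype).map φ = c.map ψ := by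
      intro m c; ext1; simp [ψ]
    rw [h1]
    refine (mnorm_map_le ψ a).trans ?_
    gcongr
    have h2 := (hj _ (OpDual.ofMap (E := V) ψ)).2
    rw [mnorm_opDual, toMap_ofMap, flip, ← h1] at h2
    refine h2.trans ?_
    gcongr
    exact hφ N _

end Duality

/-! ### Ultraproducts and representing maps -/

section Ultraproduct

lemma Ultrafilter.tendsto_limsup {ι : Type*} (U : Ultrafilter ι) (f : ι → ℝ≥0∞) :
    Tendsto f U (𝓝 (limsup f U)) := by
  obtain ⟨x, -, hx⟩ := isCompact_univ.ultrafilter_le_nhds (U.map f) (by simp)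
  have h1 : Tendsto f U (𝓝 x) := hx
  rwa [h1.limsup_eq]

lemma mnorm_le_sum {H : Type*} [NormedAddCommGroup H] [InnerProductSpace ℂ H]
    {V : Submodule ℂ (H →L[ℂ] H)} {k : ℕ} (a : Matrix (Fin k) (Fin k) V) :
    mnorm k a ≤ ENNReal.ofReal (∑ p, ∑ q, ‖a p q‖) := by
  rw [mnorm_coe, mnorm_eq_enorm_blockOp, ← ofReal_norm]
  exact ENNReal.ofReal_le_ofReal (norm_blockOp_le_sum (a.map V.subtype))

variable {E : OperatorSpace.{u}} {U : Ultrafilter ℕ} {F : ℕ → OperatorSpace.{v}} {k : ℕ}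

/-- The matrix norms of an ultraproduct do not depend on the representing families. -/
lemma Ultraproduct.tendsto_mnorm (a : Matrix (Fin k) (Fin k) (Ultraproduct U fun i => F i))
    (Y : Fin k → Fin k → lp (fun i => F i) ∞) (hY : ∀ p q, Ultraproduct.mk (Y p q) = a p q) :
    Tendsto (fun i => mnorm k (Matrix.of fun p q => Y p q i)) U (𝓝 (mnorm k a)) := by
  let Z : ∀ i, Matrix (Fin k) (Fin k) (F i) := fun i => Matrix.of fun p q => (a p q).rep i
  let Y' : ∀ i, Matrix (Fin k) (Fin k) (F i) := fun i => Matrix.of fun p q => Y p q i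
  have hnull : ∀ p q, Tendsto (fun i => ‖Y p q i - (a p q).rep i‖) U (𝓝 0) := by
    intro p q
    have h1 : (Ultraproduct.mk (a p q).rep : Ultraproduct U fun i => F i) = a p q :=
      Quotient.out_eq (a p q)
    have h2 : Y p q - (a p q).rep ∈ nullFamilies U fun i => F i :=
      (Submodule.Quotient.eq _).mp ((hY p q).trans h1.symm)
    exact h2
  have hZ : Tendsto (fun i => mnorm k (Z i)) U (𝓝 (mnorm k a)) := Ultrafilter.tendsto_limsup U _
  let d : ℕ → ℝ≥0∞ := fun i => ENNReal.ofReal (∑ p, ∑ q, ‖Y p q i - (a p q).rep i‖)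
  have hd : Tendsto d U (𝓝 0) := by
    have h1 : Tendsto (fun i => ∑ p, ∑ q, ‖Y p q i - (a p q).rep i‖) U (𝓝 0) := by
      simpa using tendsto_finsetSum Finset.univ fun p _ =>
        tendsto_finsetSum Finset.univ fun q _ => hnull p q
    have h2 := ENNReal.tendsto_ofReal h1
    rwa [ENNReal.ofReal_zero] at h2
  have hup : ∀ i, mnorm k (Y' i) ≤ mnorm k (Z i) + d i := by
    intro i
    have h1 : Y' i = Z i + (Y' i - Z i) := by abel
    rw [h1]
    exact (mnorm_add_le _ _).trans (add_le_add_right (mnorm_le_sum _) _)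
  have hlow : ∀ i, mnorm k (Z i) - d i ≤ mnorm k (Y' i) := by
    intro i
    rw [tsub_le_iff_right]
    have h1 : Z i = Y' i + (Z i - Y' i) := by abel
    rw [h1]
    refine (mnorm_add_le _ _).trans (add_le_add_right ((mnorm_le_sum _).trans_eq ?_) _)
    congr 1
    exact Finset.sum_congr rfl fun p _ => Finset.sum_congr rfl fun q _ => norm_sub_rev _ _
  refine tendsto_of_tendsto_of_tendsto_of_le_of_le ?_ ?_ hlow hup
  · simpa using ENNReal.Tendsto.sub hZ hd (Or.inr ENNReal.zero_ne_top)
  · simpa using hZ.add hd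

/-- A complete isometry from an ultraproduct onto a finite-dimensional space is represented by a
sequence of linear maps that are asymptotically isometric at every matrix level. -/
lemma exists_maps_of_ultraproduct [FiniteDimensional ℂ E]
    (h : CompletelyIsometric (Ultraproduct U fun i => F i) E) :
    ∃ u : ∀ i, E →ₗ[ℂ] F i, ∀ (k : ℕ) (a : Matrix (Fin k) (Fin k) E),
      Tendsto (fun i => mnorm k (a.map (u i))) U (𝓝 (mnorm k a)) := by
  obtain ⟨w, hw⟩ := h
  let b := Module.finBasis ℂ E
  let X := fun l => (w.symm (b l)).rep
  refine ⟨fun i => b.constr ℂ fun l => X l i, fun k a => ?_⟩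
  -- The i-th map sends each basis vector to the i-th coordinate of a representative of its preimage
  -- in the ultraproduct.
  let mkL : lp (fun i => F i) ∞ →ₗ[ℂ] Ultraproduct U fun i => F i :=
    (nullFamilies U fun i => F i).mkQ
  have h1 := Ultraproduct.tendsto_mnorm (a.map w.symm) (fun p q => ∑ l, b.repr (a p q) l • X l)
    fun p q => by
      have h2 : ∀ x : Ultraproduct U fun i => F i, mkL x.rep = x := fun x => Quotient.out_eq x
      change mkL _ = w.symm (a p q)
      rw [map_sum]
      simp_rw [map_smul, X, h2]
      conv_rhs => rw [← b.sum_repr (a p q), map_sum]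
      simp_rw [map_smul]
  have h2 : mnorm k (a.map w.symm) = mnorm k a := by
    rw [← hw]
    congr 1
    ext1
    simp
  rw [h2] at h1
  refine h1.congr fun i => congrArg (mnorm k) (Matrix.ext fun p q => ?_)
  simp only [Matrix.of_apply, Matrix.map_apply, Module.Basis.constr_apply_fintype, lp.coeFn_sum]
  exact Finset.sum_apply _ _ _

end Ultraproduct

/-! ### From the two conditions on d_SK to convergence of distances -/

section Stability

variable {E : OperatorSpace.{u}} {U : Ultrafilter ℕ} {F : ℕ → OperatorSpace.{v}}

lemma tendsto_dcb_of_dSK_eq_one [FiniteDimensional ℂ E] [Nontrivial E]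
    [∀ i, FiniteDimensional ℂ (F i)]
    (hF : ∀ i, Module.finrank ℂ E = Module.finrank ℂ (F i))
    (h₁ : dSK E = 1) (h₂ : dSK (OpDual E) = 1)
    (h : CompletelyIsometric (Ultraproduct U fun i => F i) E) :
    Tendsto (fun i => dcb E (F i)) U (𝓝 1) := by
  obtain ⟨u, hu⟩ := exists_maps_of_ultraproduct h
  have hnt : Nontrivial (OpDual E) := inferInstanceAs (Nontrivial (E →L[ℂ] ℂ))
  -- One factor bounds the cb norm of u i. The other two bound its inverse: one is the distortion of
  -- the embedding of E, one the uniform convergence on N₁ × N₁ matrices.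
  have key : ∀ ε : ℝ, 0 < ε → ∀ᶠ i in U, dcb E (F i) ≤ ENNReal.ofReal (1 + ε) ^ 3 := by
    intro ε hε
    have hr : 1 < ENNReal.ofReal (1 + ε) := by
      rw [ENNReal.one_lt_ofReal]; linarith
    obtain ⟨N₁, j₁, A₁, B₁, hA₁, hB₁, hAB₁, hj₁⟩ :=
      exists_matrix_embedding_of_dSK_lt (h₁.trans_lt hr)
    obtain ⟨N₂, j₂, A₂, B₂, hA₂, hB₂, hAB₂, hj₂⟩ :=
      exists_matrix_embedding_of_dSK_lt (h₂.trans_lt hr)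
    obtain ⟨t, htA, ht⟩ := exists_matrix_cbNorm_le j₂ hj₂
    have hcb : ∀ᶠ i in U, cbNorm (u i) < ENNReal.ofReal (1 + ε) := by
      have h3 : Tendsto (fun i => B₂ * mnorm N₂ (t.map (u i))) U (𝓝 (B₂ * mnorm N₂ t)) :=
        ENNReal.Tendsto.const_mul (hu N₂ t) (Or.inr hB₂)
      have h4 : B₂ * mnorm N₂ t < ENNReal.ofReal (1 + ε) := by
        refine lt_of_le_of_lt ?_ hAB₂
        rw [mul_comm]
        gcongr
      filter_upwards [h3.eventually (eventually_lt_nhds h4)] with i hi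
      exact (ht (u i)).trans_lt hi
    have hinv := eventually_seminorm_le (L := (U : Filter ℕ)) (p := mnormSeminorm E N₁)
      (q := fun i => (mnormSeminorm (F i) N₁).comp (u i).mapMatrix)
      (fun a ha => eq_zero_of_mnorm a
        (((ENNReal.toReal_eq_zero_iff _).mp ha).resolve_right (mnorm_ne_top a)))
      (fun a => (ENNReal.tendsto_toReal (mnorm_ne_top a)).comp (hu N₁ a)) hε
    filter_upwards [hcb, hinv] with i hi₁ hi₂
    have hi₃ : ∀ a : Matrix (Fin N₁) (Fin N₁) E,
        mnorm N₁ a ≤ ENNReal.ofReal (1 + ε) * mnorm N₁ (a.map (u i)) := by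
      intro a
      have h3 : (mnorm N₁ a).toReal ≤ (1 + ε) * (mnorm N₁ (a.map (u i))).toReal := hi₂ a
      rw [← ENNReal.ofReal_toReal (mnorm_ne_top a), ← ENNReal.ofReal_toReal
        (mnorm_ne_top (a.map (u i))), ← ENNReal.ofReal_mul (by positivity)]
      exact ENNReal.ofReal_le_ofReal h3
    set C := A₁ * ENNReal.ofReal (1 + ε) with hC
    have hCt : ENNReal.ofReal C.toReal = C :=
      ENNReal.ofReal_toReal (ENNReal.mul_ne_top hA₁ ENNReal.ofReal_ne_top)
    -- Since j₁ takes values in M_{N₁}, Smith's lemma extends the comparison of j₁ with u i from N₁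
    -- × N₁ matrices to all sizes.
    have hbelow : ∀ (k : ℕ) (a : Matrix (Fin k) (Fin k) E),
        mnorm k a ≤ B₁ * C * mnorm k (a.map (u i)) := by
      intro k a
      refine ((hj₁ k a).2).trans ?_
      rw [mul_assoc]
      gcongr
      have h3 : ∀ {m : ℕ} (c : Matrix (Fin m) (Fin m) E),
          mnorm m (c.map (u i)) = mnorm m (c.map ((F i).carrier.subtype ∘ₗ u i)) := fun c => rfl
      rw [h3, ← hCt, mnorm_le_mul_iff ENNReal.toReal_nonneg]
      refine norm_blockOp_map_le_of_le le_rfl _ _ ENNReal.toReal_nonneg (fun c => ?_) a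
      rw [← mnorm_le_mul_iff ENNReal.toReal_nonneg, hCt, hC, ← h3, mul_assoc]
      exact (hj₁ N₁ c).1.trans (mul_le_mul_right (hi₃ c) _)
    have hinj : Function.Injective (u i) := by
      rw [← LinearMap.ker_eq_bot, LinearMap.ker_eq_bot']
      intro x hx
      have h3 := hbelow 1 (Matrix.of fun _ _ => x)
      have h4 : (Matrix.of fun _ _ : Fin 1 => x).map (u i) = 0 := by
        ext1 p q
        exact hx
      rw [h4, mnorm_zero, mul_zero, nonpos_iff_eq_zero] at h3
      exact congrFun (congrFun (eq_zero_of_mnorm _ h3) 0) 0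
    let w : E ≃ₗ[ℂ] F i := LinearMap.linearEquivOfInjective (u i) hinj (hF i)
    have hw : (w : E →ₗ[ℂ] F i) = u i := by ext1 x; rfl
    have hsymm : cbNorm (w.symm : F i →ₗ[ℂ] E) ≤ B₁ * C := by
      refine cbNorm_le fun k b => ?_
      have h3 := hbelow k (b.map (w.symm : F i →ₗ[ℂ] E))
      have h4 : (b.map (w.symm : F i →ₗ[ℂ] E)).map (u i) = b := by
        rw [← hw]; ext1; simp
      rwa [h4] at h3
    refine (iInf_le _ w).trans ?_
    rw [hw]
    calc _ ≤ ENNReal.ofReal (1 + ε) * (ENNReal.ofReal (1 + ε) * ENNReal.ofReal (1 + ε)) := by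
          refine mul_le_mul' hi₁.le (hsymm.trans ?_)
          rw [hC, ← mul_assoc, mul_comm B₁]
          gcongr
      _ = _ := by ring
  rw [tendsto_order]
  refine ⟨fun r hr => Eventually.of_forall fun i => hr.trans_le one_le_dcb, fun r hr => ?_⟩
  have h3 : Tendsto (fun ε : ℝ => ENNReal.ofReal (1 + ε) ^ 3) (𝓝[>] 0) (𝓝 1) := by
    have h4 : Tendsto (fun ε : ℝ => ENNReal.ofReal (1 + ε) ^ 3) (𝓝 0)
        (𝓝 (ENNReal.ofReal (1 + 0) ^ 3)) :=
      ((ENNReal.continuous_pow 3).comp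
        (ENNReal.continuous_ofReal.comp (continuous_const.add continuous_id))).tendsto 0
    rw [add_zero, ENNReal.ofReal_one, one_pow] at h4
    exact h4.mono_left nhdsWithin_le_nhds
  obtain ⟨ε, h5, h6⟩ := ((h3.eventually (eventually_lt_nhds hr)).and self_mem_nhdsWithin).exists
  filter_upwards [key ε h6] with i hi
  exact hi.trans_lt h5

end Stability

/-! ### Norms of 1 × 1 matrices -/

section LevelOne

variable {H : Type*} [NormedAddCommGroup H] [InnerProductSpace ℂ H] {V : Submodule ℂ (H →L[ℂ] H)}

lemma mnorm_one_eq_ofReal_norm (x : V) :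
    mnorm 1 (Matrix.of fun _ _ => x) = ENNReal.ofReal ‖x‖ := by
  refine le_antisymm ((mnorm_le_sum _).trans_eq (by simp)) ?_
  rw [mnorm_coe, mnorm_eq_enorm_blockOp, ← ofReal_norm]
  exact ENNReal.ofReal_le_ofReal
    (norm_entry_le ((Matrix.of fun _ _ : Fin 1 => x).map V.subtype) 0 0)

lemma norm_le_of_mnorm_one_le {T : H →L[ℂ] H} {r : ℝ} (hr : 0 ≤ r)
    (h : mnorm 1 (Matrix.of fun _ _ => T) ≤ ENNReal.ofReal r) : ‖T‖ ≤ r :=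
  (norm_entry_le (Matrix.of fun _ _ : Fin 1 => T) 0 0).trans
    ((ENNReal.ofReal_le_ofReal_iff hr).mp (le_of_eq_of_le (ofReal_norm (blockOp (Matrix.of fun _ _ : Fin 1 => T))) h))

lemma norm_eq_of_mnorm_one_eq {H' : Type*} [NormedAddCommGroup H'] [InnerProductSpace ℂ H']
    {W : Submodule ℂ (H' →L[ℂ] H')} (e : V →ₗ[ℂ] W)
    (h : ∀ a : Matrix (Fin 1) (Fin 1) V, mnorm 1 (a.map e) = mnorm 1 a) (x : V) :
    ‖e x‖ = ‖x‖ := by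
  have h1 := h (Matrix.of fun _ _ => x)
  have h2 : (Matrix.of fun _ _ : Fin 1 => x).map e = Matrix.of fun _ _ => e x := rfl
  rw [h2, mnorm_one_eq_ofReal_norm, mnorm_one_eq_ofReal_norm] at h1
  exact (ENNReal.ofReal_eq_ofReal_iff (norm_nonneg _) (norm_nonneg _)).mp h1

end LevelOne

/-! ### Operator space structures defined by families of maps -/

section Realization

variable {H : Type*} [NormedAddCommGroup H] [InnerProductSpace ℂ H] {V : Submodule ℂ (H →L[ℂ] H)}
  [FiniteDimensional ℂ V]

/-- A family of maps into matrix algebras that norms a finite-dimensional space at the first level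
defines an operator space structure on it. -/
lemma exists_operatorSpace_of_family {ι : Type v} {m : ι → ℕ}
    (φ : ∀ s, V →ₗ[ℂ] (EuclideanSpace ℂ (Fin (m s)) →L[ℂ] EuclideanSpace ℂ (Fin (m s))))
    (h : ∀ a : Matrix (Fin 1) (Fin 1) V, ⨆ s, mnorm 1 (a.map (φ s)) = mnorm 1 a) :
    ∃ (F : OperatorSpace.{v}) (e : V ≃ₗ[ℂ] F), ∀ (k : ℕ) (a : Matrix (Fin k) (Fin k) V),
      mnorm k (a.map e) = ⨆ s, mnorm k (a.map (φ s)) := by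
  have hφ : ∀ x, ∃ K : ℝ, 0 ≤ K ∧ ∀ s, ‖φ s x‖ ≤ K := by
    refine fun x => ⟨‖x‖, norm_nonneg _, fun s => ?_⟩
    have h1 : mnorm 1 ((Matrix.of fun _ _ : Fin 1 => x).map (φ s)) ≤ ENNReal.ofReal ‖x‖ := by
      rw [← mnorm_one_eq_ofReal_norm, ← h]
      exact le_iSup (fun s => mnorm 1 ((Matrix.of fun _ _ : Fin 1 => x).map (φ s))) s
    exact norm_le_of_mnorm_one_le (norm_nonneg _) h1
  let D := directSum φ hφ
  have hinj : Function.Injective D := by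
    rw [← LinearMap.ker_eq_bot, LinearMap.ker_eq_bot']
    intro x hx
    have h1 := h (Matrix.of fun _ _ => x)
    rw [← mnorm_directSum (hφ := hφ)] at h1
    have h2 : (Matrix.of fun _ _ : Fin 1 => x).map D = 0 := by
      ext1 p q
      exact hx
    rw [h2, mnorm_zero] at h1
    exact congrFun (congrFun (eq_zero_of_mnorm _ h1.symm) 0) 0
  have hw : ∀ (k : ℕ) (a : Matrix (Fin k) (Fin k) V),
      mnorm k (a.map (LinearEquiv.ofInjective D hinj)) = mnorm k (a.map D) := fun _ _ => rfl
  exact ⟨⟨lp (fun s => EuclideanSpace ℂ (Fin (m s))) 2, LinearMap.range D,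
    (LinearMap.range D).closed_of_finiteDimensional⟩, LinearEquiv.ofInjective D hinj,
    fun k a => (hw k a).trans (mnorm_directSum a)⟩

/-- A class of maps into matrix algebras that norms a finite-dimensional space at the first level
defines an operator space structure on it, in any universe. -/
lemma exists_operatorSpace_mnorm_eq_iSup
    (Q : ∀ m : ℕ, Set (V →ₗ[ℂ] (EuclideanSpace ℂ (Fin m) →L[ℂ] EuclideanSpace ℂ (Fin m))))
    (h : ∀ a : Matrix (Fin 1) (Fin 1) V,
      ⨆ s : (Σ m, Q m), mnorm 1 (a.map s.2.1) = mnorm 1 a) :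
    ∃ (F : OperatorSpace.{v}) (e : V ≃ₗ[ℂ] F), ∀ (k : ℕ) (a : Matrix (Fin k) (Fin k) V),
      mnorm k (a.map e) = ⨆ s : (Σ m, Q m), mnorm k (a.map s.2.1) := by
  let b := Module.finBasis ℂ V
  -- A map is determined by its values on a basis, so the family is indexed by a type in the lowest
  -- universe, which can then be lifted to universe v.
  let code : (Σ m, Q m) → Σ m, (Fin (Module.finrank ℂ V) →
    (EuclideanSpace ℂ (Fin m) →L[ℂ] EuclideanSpace ℂ (Fin m))) := fun s => ⟨s.1, fun l => s.2.1 (b l)⟩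
  choose c hc using fun p : Set.range code => p.2
  have hcode : Function.Injective code := by
    rintro ⟨m, ψ⟩ ⟨m', ψ'⟩ hs
    obtain rfl : m = m' := congrArg Sigma.fst hs
    have h1 := eq_of_heq (Sigma.mk.inj hs).2
    obtain rfl : ψ = ψ' := Subtype.ext (b.ext fun l => congrFun h1 l)
    rfl
  have hsurj : Function.Surjective fun p : ULift.{v} (Set.range code) => c p.down := fun s =>
    ⟨⟨⟨code s, s, rfl⟩⟩, hcode (hc _)⟩
  have hsup : ∀ (k : ℕ) (a : Matrix (Fin k) (Fin k) V),
      ⨆ p : ULift.{v} (Set.range code), mnorm k (a.map (c p.down).2.1)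
        = ⨆ s : (Σ m, Q m), mnorm k (a.map s.2.1) := fun k a =>
    hsurj.iSup_comp (g := fun s : (Σ m, Q m) => mnorm k (a.map s.2.1))
  obtain ⟨F, e, he⟩ := exists_operatorSpace_of_family
    (fun p : ULift.{v} (Set.range code) => (c p.down).2.1) fun a => (hsup 1 a).trans (h a)
  exact ⟨F, e, fun k a => (he k a).trans (hsup k a)⟩

end Realization

/-! ### Ultraproducts of structures agreeing on larger and larger matrices -/

section ApproximatingSequence

variable {E : OperatorSpace.{u}} {U : Ultrafilter ℕ} {F : ℕ → OperatorSpace.{v}}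

/-- A sequence of operator space structures on `E` that agree with `E` on larger and larger
matrices has ultraproduct `E`. -/
lemma completelyIsometric_ultraproduct [FiniteDimensional ℂ E] (hU : (U : Filter ℕ) ≤ cofinite)
    (e : ∀ i, E ≃ₗ[ℂ] F i)
    (he : ∀ i k, k ≤ i + 1 → ∀ a : Matrix (Fin k) (Fin k) E, mnorm k (a.map (e i)) = mnorm k a) :
    CompletelyIsometric (Ultraproduct U fun i => F i) E := by
  -- The bound k ≤ i + 1 includes size 1 for every i, so even e 0 is isometric.
  have hn : ∀ i x, ‖e i x‖ = ‖x‖ := fun i =>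
    norm_eq_of_mnorm_one_eq (e i : E →ₗ[ℂ] F i) (he i 1 (by omega))
  let c : E →ₗ[ℂ] lp (fun i => F i) ∞ :=
    { toFun := fun x => ⟨fun i => e i x, memℓp_infty ⟨‖x‖, by
        rintro _ ⟨i, rfl⟩
        exact (hn i x).le⟩⟩
      map_add' := fun x y => by ext1; funext i; exact map_add (e i) x y
      map_smul' := fun r x => by ext1; funext i; exact map_smul (e i) r x }
  let mkL : lp (fun i => F i) ∞ →ₗ[ℂ] Ultraproduct U fun i => F i :=
    (nullFamilies U fun i => F i).mkQ
  have hinj : Function.Injective (mkL ∘ₗ c) := by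
    rw [← LinearMap.ker_eq_bot, LinearMap.ker_eq_bot']
    intro x hx
    have h1 : c x ∈ nullFamilies U fun i => F i := (Submodule.Quotient.mk_eq_zero _).mp hx
    have h2 : Tendsto (fun i => ‖e i x‖) U (𝓝 0) := h1
    simp_rw [hn] at h2
    exact norm_eq_zero.mp (tendsto_nhds_unique tendsto_const_nhds h2)
  have hsurj : Function.Surjective (mkL ∘ₗ c) := by
    intro y
    obtain ⟨Y, rfl⟩ : ∃ Y, mkL Y = y := Submodule.mkQ_surjective _ y
    have : ProperSpace E := FiniteDimensional.proper ℂ E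
    have hz : ∀ i, ‖(e i).symm (Y i)‖ ≤ ‖Y‖ := fun i => by
      rw [← hn i, LinearEquiv.apply_symm_apply]
      exact lp.norm_apply_le_norm ENNReal.top_ne_zero Y i
    -- A bounded family pulls back to a ball of E, which is compact; its limit along U is the
    -- preimage.
    obtain ⟨z, -, hzU⟩ := (isCompact_closedBall (0 : E) ‖Y‖).ultrafilter_le_nhds
      (U.map fun i => (e i).symm (Y i)) (by
        rw [le_principal_iff]
        exact Filter.mem_map.mpr (Filter.univ_mem' fun i => by simpa using hz i))
    have hz' : Tendsto (fun i => (e i).symm (Y i)) U (𝓝 z) := hzU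
    refine ⟨z, (Submodule.Quotient.eq _).mpr ?_⟩
    have h1 : Tendsto (fun i => ‖z - (e i).symm (Y i)‖) U (𝓝 0) := by
      simpa using (tendsto_const_nhds.sub hz').norm (a := (z - z : E))
    refine h1.congr fun i => ?_
    rw [← hn i, map_sub, LinearEquiv.apply_symm_apply]
    rfl
  let w : E ≃ₗ[ℂ] Ultraproduct U fun i => F i := LinearEquiv.ofBijective (mkL ∘ₗ c) ⟨hinj, hsurj⟩
  refine ⟨w.symm, fun k a => ?_⟩
  have h1 := Ultraproduct.tendsto_mnorm a (fun p q => c (w.symm (a p q)))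
    fun p q => w.apply_symm_apply (a p q)
  have h2 : ∀ᶠ i in (U : Filter ℕ),
      mnorm k (Matrix.of fun p q => c (w.symm (a p q)) i) = mnorm k (a.map w.symm) := by
    have h3 : ∀ᶠ i in (U : Filter ℕ), k ≤ i := by
      rw [Nat.cofinite_eq_atTop] at hU
      exact hU (eventually_ge_atTop k)
    filter_upwards [h3] with i hi
    exact he i k (by omega) (a.map w.symm)
  exact tendsto_nhds_unique (tendsto_const_nhds.congr' (h2.mono fun i hi => hi.symm)) h1

end ApproximatingSequence

/-! ### Evaluation of functionals and transposition -/

section EvalMatrix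

variable {H : Type*} [NormedAddCommGroup H] [InnerProductSpace ℂ H] {V : Submodule ℂ (H →L[ℂ] H)}

/-- Evaluation of functionals at a matrix over `V`. -/
noncomputable def evalMatrix {k : ℕ} (t : Matrix (Fin k) (Fin k) V) :
    OpDual V →ₗ[ℂ] (EuclideanSpace ℂ (Fin k) →L[ℂ] EuclideanSpace ℂ (Fin k)) where
  toFun f := Matrix.toEuclideanCLM (n := Fin k) (𝕜 := ℂ) (t.map f.toCLM)
  map_add' f g := by
    rw [← map_add]
    rfl
  map_smul' c f := by
    rw [← map_smul]
    rfl

lemma mnorm_map_evalMatrix {k m : ℕ} (t : Matrix (Fin k) (Fin k) V)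
    (f : Matrix (Fin m) (Fin m) (OpDual V)) :
    mnorm m (f.map (evalMatrix t)) = mnorm k (t.map (OpDual.toMap f)) := by
  refine mnorm_flip fun i j p q => ?_
  refine Eq.trans ?_ (toMap_apply_single f (t p q) i j).symm
  change Matrix.toEuclideanCLM (n := Fin k) (𝕜 := ℂ) _ _ p = _
  simp [Matrix.ofLp_toEuclideanCLM]

end EvalMatrix

section DualMap

variable {H H' : Type*} [NormedAddCommGroup H] [InnerProductSpace ℂ H] [NormedAddCommGroup H']
  [InnerProductSpace ℂ H'] {V : Submodule ℂ (H →L[ℂ] H)} {W : Submodule ℂ (H' →L[ℂ] H')}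
  [FiniteDimensional ℂ V]

/-- The transpose of a linear map. -/
noncomputable def OpDual.transpose (u : V →ₗ[ℂ] W) : OpDual W →ₗ[ℂ] OpDual V where
  toFun f := OpDual.ofDual (E := V) ((f.toCLM : W →ₗ[ℂ] ℂ) ∘ₗ u)
  map_add' _ _ := OpDual.ext fun _ => rfl
  map_smul' _ _ := OpDual.ext fun _ => rfl

lemma cbNorm_transpose_le (u : V →ₗ[ℂ] W) : cbNorm (OpDual.transpose u) ≤ cbNorm u := by
  refine cbNorm_le fun k f => ?_
  have h1 : OpDual.toMap (f.map (OpDual.transpose u)) = OpDual.toMap f ∘ₗ u := rfl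
  rw [mnorm_opDual, mnorm_opDual, h1, mul_comm]
  exact cbNorm_comp_le _ _

lemma dcb_opDual_le [FiniteDimensional ℂ W] : dcb (OpDual V) (OpDual W) ≤ dcb V W := by
  refine le_iInf fun u => ?_
  let w : OpDual V ≃ₗ[ℂ] OpDual W := LinearEquiv.ofLinearMap
    (OpDual.transpose (u.symm : W →ₗ[ℂ] V)) (OpDual.transpose (u : V →ₗ[ℂ] W))
    (LinearMap.ext fun f => OpDual.ext fun x => congrArg f.toCLM (u.apply_symm_apply x))
    (LinearMap.ext fun f => OpDual.ext fun x => congrArg f.toCLM (u.symm_apply_apply x))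
  refine (iInf_le _ w).trans ?_
  rw [mul_comm]
  exact mul_le_mul' (cbNorm_transpose_le (u : V →ₗ[ℂ] W))
    (cbNorm_transpose_le (u.symm : W →ₗ[ℂ] V))

end DualMap

/-! ### The smallest and the largest structure agreeing up to a given size -/

section MinMax

variable {H : Type*} [NormedAddCommGroup H] [InnerProductSpace ℂ H]

/-- The maps from `V` to `Mₘ` that are contractive on matrices of size at most `N`. -/
def contractiveUpTo (V : Submodule ℂ (H →L[ℂ] H)) (N m : ℕ) :
    Set (V →ₗ[ℂ] (EuclideanSpace ℂ (Fin m) →L[ℂ] EuclideanSpace ℂ (Fin m))) :=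
  {ψ | ∀ k ≤ N, ∀ a : Matrix (Fin k) (Fin k) V, mnorm k (a.map ψ) ≤ mnorm k a}

/-- The complete contractions from `V` to `Mₘ`, for `m ≤ N`. -/
def completeContractions (V : Submodule ℂ (H →L[ℂ] H)) (N m : ℕ) :
    Set (V →ₗ[ℂ] (EuclideanSpace ℂ (Fin m) →L[ℂ] EuclideanSpace ℂ (Fin m))) :=
  {ψ | m ≤ N ∧ ∀ (k : ℕ) (a : Matrix (Fin k) (Fin k) V), mnorm k (a.map ψ) ≤ mnorm k a}

variable {V : Submodule ℂ (H →L[ℂ] H)} {N : ℕ}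

/-- For k ≤ N the complete contractions into M_k already norm the k × k matrices, and no member of Q
exceeds the norm there. -/
lemma iSup_mnorm_map_eq [CompleteSpace H]
    {Q : ∀ m : ℕ, Set (V →ₗ[ℂ] (EuclideanSpace ℂ (Fin m) →L[ℂ] EuclideanSpace ℂ (Fin m)))}
    (h₁ : ∀ m, completeContractions V N m ⊆ Q m) (h₂ : ∀ m, Q m ⊆ contractiveUpTo V N m) {k : ℕ}
    (hk : k ≤ N) (a : Matrix (Fin k) (Fin k) V) :
    ⨆ s : (Σ m, Q m), mnorm k (a.map s.2.1) = mnorm k a := by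
  refine le_antisymm (iSup_le fun s => h₂ _ s.2.2 k hk a) ?_
  rw [mnorm_coe]
  refine mnorm_le_of_forall_completeContraction _ _ fun φ hφ => ?_
  exact le_iSup (fun s : (Σ m, Q m) => mnorm k (a.map s.2.1))
    ⟨k, φ ∘ₗ V.subtype, h₁ k ⟨hk, fun m b => hφ m (b.map V.subtype)⟩⟩

/-- In the largest structure, a map into a matrix algebra that is bounded by R on matrices of size
at most N has cb norm at most R. Thus the dual is normed by evaluations at such matrices. -/
lemma dSK_opDual_le_one_of_contractiveUpTo {H : Type*} [NormedAddCommGroup H]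
    [InnerProductSpace ℂ H] {V : Submodule ℂ (H →L[ℂ] H)} {N : ℕ} {F : OperatorSpace.{v}}
    [FiniteDimensional ℂ F] (e : V ≃ₗ[ℂ] F)
    (heN : ∀ k ≤ N, ∀ a : Matrix (Fin k) (Fin k) V, mnorm k (a.map e) = mnorm k a)
    (he : ∀ (k : ℕ) (a : Matrix (Fin k) (Fin k) V), mnorm k (a.map e)
      = ⨆ s : (Σ m, contractiveUpTo V N m), mnorm k (a.map s.2.1)) :
    dSK (OpDual F) ≤ 1 := by
  refine dSK_le_one_of_mnorm_eq_iSup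
    (S := Σ k : Fin (N + 1), {c : Matrix (Fin k) (Fin k) V // mnorm k c ≤ 1})
    (m := fun s => s.1) (fun s => Nat.lt_succ_iff.mp s.1.2)
    (fun s => evalMatrix (s.2.1.map e)) fun m f => ?_
  simp_rw [mnorm_map_evalMatrix]
  refine le_antisymm ?_ (iSup_le fun s => ?_)
  · set R := ⨆ s : Σ k : Fin (N + 1), {c : Matrix (Fin k) (Fin k) V // mnorm k c ≤ 1},
      mnorm s.1 ((s.2.1.map e).map (OpDual.toMap f)) with hR
    let ψ := OpDual.toMap f ∘ₗ (e : V →ₗ[ℂ] F)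
    have hψ : ∀ k ≤ N, ∀ c : Matrix (Fin k) (Fin k) V, mnorm k (c.map ψ) ≤ R * mnorm k c :=
      fun k hk c => mnorm_map_le_of_forall_le_one (fun c hc =>
        le_iSup (fun s : Σ k : Fin (N + 1), {c : Matrix (Fin k) (Fin k) V // mnorm k c ≤ 1} =>
          mnorm s.1 ((s.2.1.map e).map (OpDual.toMap f))) ⟨⟨k, by omega⟩, c, hc⟩) c
    refine le_of_forall_gt fun r hr => ?_
    -- Division by r' instead of R, since R may vanish; r' is nonzero and finite.
    obtain ⟨r', hr', hrr'⟩ := exists_between hr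
    refine lt_of_le_of_lt ?_ hrr'
    have hr0 : r' ≠ 0 := (bot_le.trans_lt hr').ne'
    have hrt : r' ≠ ⊤ := hrr'.ne_top
    let c : ℂ := ((r'.toReal⁻¹ : ℝ) : ℂ)
    have hce : ‖c‖ₑ = r'⁻¹ := by
      rw [← ofReal_norm, Complex.norm_real, Real.norm_of_nonneg (by positivity),
        ENNReal.ofReal_inv_of_pos (ENNReal.toReal_pos hr0 hrt), ENNReal.ofReal_toReal hrt]
    let χ : V →ₗ[ℂ] (EuclideanSpace ℂ (Fin m) →L[ℂ] EuclideanSpace ℂ (Fin m)) := c • ψ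
    have hsmul : ∀ {k : ℕ} (a : Matrix (Fin k) (Fin k) V),
        mnorm k (a.map χ) = r'⁻¹ * mnorm k (a.map ψ) := by
      intro k a
      rw [← hce, ← mnorm_smul]
      rfl
    have hmem : χ ∈ contractiveUpTo V N m := by
      intro k hk a
      rw [hsmul]
      calc _ ≤ r'⁻¹ * (r' * mnorm k a) := by
            gcongr
            exact (hψ k hk a).trans (by gcongr)
        _ = mnorm k a := by rw [← mul_assoc, ENNReal.inv_mul_cancel hr0 hrt, one_mul]
    rw [mnorm_opDual]
    refine cbNorm_le fun k b => ?_
    have h1 : (b.map e.symm).map e = b := by ext1; simp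
    have h2 : mnorm k ((b.map e.symm).map χ) ≤ mnorm k ((b.map e.symm).map e) :=
      (le_iSup (fun s : (Σ m, contractiveUpTo V N m) => mnorm k ((b.map e.symm).map s.2.1))
        ⟨m, χ, hmem⟩).trans_eq (he k _).symm
    have h3 : (b.map e.symm).map ψ = b.map (OpDual.toMap f) := by ext1; simp [ψ]
    rw [h1, hsmul] at h2
    rw [h3, ENNReal.inv_mul_le_iff hr0 hrt] at h2
    exact h2
  · refine (mnorm_map_le (OpDual.toMap f) _).trans ?_
    rw [mnorm_opDual]
    calc _ ≤ cbNorm (OpDual.toMap f) * 1 := by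
          gcongr
          rw [heN _ (Nat.lt_succ_iff.mp s.1.2)]
          exact s.2.2
      _ = _ := mul_one _

lemma dSK_le_one_of_completeContractions {H : Type*} [NormedAddCommGroup H]
    [InnerProductSpace ℂ H] {V : Submodule ℂ (H →L[ℂ] H)} {N : ℕ} {F : OperatorSpace.{v}}
    [FiniteDimensional ℂ F] (e : V ≃ₗ[ℂ] F)
    (he : ∀ (k : ℕ) (a : Matrix (Fin k) (Fin k) V), mnorm k (a.map e)
      = ⨆ s : (Σ m, completeContractions V N m), mnorm k (a.map s.2.1)) :
    dSK F ≤ 1 := by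
  refine dSK_le_one_of_mnorm_eq_iSup (S := Σ m, completeContractions V N m) (m := fun s => s.1)
    (fun s => s.2.2.1) (fun s => s.2.1 ∘ₗ (e.symm : F →ₗ[ℂ] V)) fun k a => ?_
  have h1 : a = (a.map e.symm).map e := by ext1; simp
  conv_lhs => rw [h1, he]
  rfl

end MinMax

/-! ### Approximating sequences and the equivalence -/

section Necessity

variable {E : OperatorSpace.{u}} {U : Ultrafilter ℕ}

lemma exists_approximating_sequence [FiniteDimensional ℂ E] (hU : (U : Filter ℕ) ≤ cofinite)
    (Q : ∀ _N m : ℕ,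
      Set (E →ₗ[ℂ] (EuclideanSpace ℂ (Fin m) →L[ℂ] EuclideanSpace ℂ (Fin m))))
    (h₁ : ∀ N m, completeContractions E.carrier N m ⊆ Q N m)
    (h₂ : ∀ N m, Q N m ⊆ contractiveUpTo E.carrier N m) :
    ∃ (F : ℕ → OperatorSpace.{v}) (e : ∀ i, E ≃ₗ[ℂ] F i),
      CompletelyIsometric (Ultraproduct U fun i => F i) E ∧
      (∀ i, Nonempty (F i ≃ₗᵢ[ℂ] E)) ∧
      (∀ i, ∀ k ≤ i + 1, ∀ a : Matrix (Fin k) (Fin k) E, mnorm k (a.map (e i)) = mnorm k a) ∧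
      ∀ i k (a : Matrix (Fin k) (Fin k) E), mnorm k (a.map (e i))
        = ⨆ s : (Σ m, Q (i + 1) m), mnorm k (a.map s.2.1) := by
  have hlevel := fun (N k : ℕ) (hk : k ≤ N) (a : Matrix (Fin k) (Fin k) E) =>
    iSup_mnorm_map_eq (h₁ N) (h₂ N) hk a
  choose F e he using fun i : ℕ =>
    exists_operatorSpace_mnorm_eq_iSup.{v} (Q (i + 1)) (hlevel (i + 1) 1 (by omega))
  have heN : ∀ i, ∀ k ≤ i + 1, ∀ a : Matrix (Fin k) (Fin k) E,
      mnorm k (a.map (e i)) = mnorm k a := fun i k hk a => by rw [he, hlevel _ _ hk]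
  refine ⟨F, e, completelyIsometric_ultraproduct hU e heN, fun i => ?_, heN, he⟩
  exact ⟨(⟨e i, norm_eq_of_mnorm_one_eq (e i : E →ₗ[ℂ] F i) (heN i 1 (by omega))⟩ :
    E ≃ₗᵢ[ℂ] F i).symm⟩

end Necessity

end OpSp

theorem corollary15 (n : ℕ) (hn : 1 ≤ n) (U : Ultrafilter ℕ) (hU : (U : Filter ℕ) ≤ cofinite)
    (E : OperatorSpace.{u}) (hE : E ∈ OS n) :
    List.TFAE [
      dSK E = 1 ∧ dSK (OpDual E) = 1,
      ∀ F : ℕ → OperatorSpace.{v}, (∀ i, F i ∈ OS n) →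
        CompletelyIsometric (Ultraproduct U fun i => F i) E →
          Tendsto (fun i => dcb E (F i)) U (𝓝 1),
      ∀ F : ℕ → OperatorSpace.{v}, (∀ i, F i ∈ OS n) →
        (∀ i, Nonempty (F i ≃ₗᵢ[ℂ] E)) →
        CompletelyIsometric (Ultraproduct U fun i => F i) E →
          Tendsto (fun i => dcb E (F i)) U (𝓝 1)] := by
  obtain ⟨hfd, hfr⟩ := hE
  -- The lower bound 1 for the distances fails on the zero space; this is where n ≥ 1 enters.
  have hnt : Nontrivial E := Module.nontrivial_of_finrank_pos (R := ℂ) (by omega)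
  have hntd : Nontrivial (OpDual E) := inferInstanceAs (Nontrivial (E →L[ℂ] ℂ))
  tfae_have 1 → 2 := fun ⟨h₁, h₂⟩ F hF h => by
    have hFfd : ∀ i, FiniteDimensional ℂ (F i) := fun i => (hF i).1
    exact tendsto_dcb_of_dSK_eq_one (fun i => hfr.trans (hF i).2.symm) h₁ h₂ h
  tfae_have 2 → 3 := fun h F hF _ => h F hF
  tfae_have 3 → 1 := fun h => by
    have hsub : ∀ N m, completeContractions E.carrier N m ⊆ contractiveUpTo E.carrier N m :=
      fun _ _ ψ hψ k _ a => hψ.2 k a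
    have hOS : ∀ F : OperatorSpace.{v}, (E ≃ₗ[ℂ] F) → F ∈ OS n := fun F e =>
      ⟨e.finiteDimensional, by rw [← hfr, e.finrank_eq]⟩
    constructor
    · obtain ⟨F, e, hci, hiso, -, he⟩ := exists_approximating_sequence.{u, v} hU
        (completeContractions E.carrier) (fun _ _ => le_rfl) hsub
      refine le_antisymm (ge_of_tendsto (h F (fun i => hOS _ (e i)) hiso hci)
        (Eventually.of_forall fun i => ?_)) one_le_dSK
      have : FiniteDimensional ℂ (F i) := (e i).finiteDimensional
      exact dSK_le_dcb (dSK_le_one_of_completeContractions (e i) (he i))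
    · obtain ⟨F, e, hci, hiso, heN, he⟩ := exists_approximating_sequence.{u, v} hU
        (contractiveUpTo E.carrier) hsub (fun _ _ => le_rfl)
      refine le_antisymm (ge_of_tendsto (h F (fun i => hOS _ (e i)) hiso hci)
        (Eventually.of_forall fun i => ?_)) one_le_dSK
      have : FiniteDimensional ℂ (F i) := (e i).finiteDimensional
      exact (dSK_le_dcb (dSK_opDual_le_one_of_contractiveUpTo (e i) (heN i) (he i))).trans
        dcb_opDual_le
  tfae_finish
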